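/- For $a>b>0$ and $n\in\mathbb N$ (large enough that $a/n\le 1$), let $\mathcal G(n,\frac an,\frac bn)$ be the planted bisection model: each of the $n$ vertices independently receives a uniformly random label in $\{+,-\}$ and, given the labels, each possible edge is present independently, with probability $a/n$ if its endpoints have the same label and $b/n$ if they have different labels. Let $\mathbb P_n=\mathbb P_n^{(a,b)}$ be the law of the resulting unlabelled graph, and let $\mathbb P_n'$ be the law of the Erdős–Rényi graph $\mathcal G(n,\frac{a+b}{2n})$. **Theorem.** Let $a>b>0$ be fixed with $(a-b)^2<2(a+b)$. 1. $\mathbb P_n$ and $\mathbb P_n'$ are mutually contiguous: for every sequence of events $A_n$ (sets of graphs on $n$ vertices), $\mathbb P_n(A_n)\to0$ if and only if $\mathbb P'_n(A_n)\to 0$. 2. There is no consistent estimator for $a$ and none for $b$. Precisely, let $\Theta\subseteq\{(\alpha,\beta):\alpha>\beta>0\}$ be any parameter set that contains $(a,b)$ and at least one further point $(\alpha,\beta)\neq(a,b)$ with $\alpha+\beta=a+b$ and $(\alpha-\beta)^2<2(\alpha+\beta)$ (for example $\Theta=\{(\alpha,\beta):\alpha>\beta>0,\ (\alpha-\beta)^2<2(\alpha+\beta)\}$,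 or any neighbourhood of $(a,b)$ in $\{(\alpha,\beta):\alpha>\beta>0\}$). Then there is no sequence of real-valued functions $\hat a_n$ of the unlabelled graph on $n$ vertices such that for every $(\alpha,\beta)\in\Theta$ and every $\varepsilon>0$, $\mathbb P_n^{(\alpha,\beta)}(|\hat a_n-\alpha|>\varepsilon)\to0$; likewise there is no sequence $\hat b_n$ such that for every $(\alpha,\beta)\in\Theta$ and every $\varepsilon>0$, $\mathbb P_n^{(\alpha,\beta)}(|\hat b_n-\beta|>\varepsilon)\to0$. -/

import Mathlib

open MeasureTheory ProbabilityTheory Filter Topology unitInterval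

namespace BlockModel

noncomputable section

/-- The law of a random simple graph on `V` in which the possible edges are present independently
of each other, the edge `e` with probability `r e`. (One independent Bernoulli variable is drawn for
every element of `Sym2 V`; those on the diagonal are discarded by `fromEdgeSet`.) -/
def independentEdges {V : Type} [Fintype V] [DecidableEq V] (r : Sym2 V → I) :
    Measure (SimpleGraph V) :=
  (Measure.pi fun e : Sym2 V ↦ toNNReal (r e) • Measure.dirac True
      + toNNReal (unitInterval.symm (r e)) • Measure.dirac False).map
    fun ω : Sym2 V → Prop ↦ SimpleGraph.fromEdgeSet {e | ω e}

/-- The edge probabilities given the labels `s`: the edge `s(u, v)` has probability `p` if the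
labels of `u` and `v` agree and probability `q` if they differ. -/
def edgeProb {V : Type} (p q : I) (s : V → Bool) : Sym2 V → I :=
  Sym2.lift ⟨fun u v ↦ if s u = s v then p else q, fun u v ↦ by simp only [eq_comm]⟩

/-- The planted bisection model with parameters `p`, `q` on the vertex set `Fin n`, a law of labelled
graphs: the labels of the vertices are independent and uniform on a two-point set, and, given the
labels, the edges are independent with the probabilities `edgeProb p q`. -/
def plantedBisection (n : ℕ) (p q : I) : Measure ((Fin n → Bool) × SimpleGraph (Fin n)) :=
  (Measure.pi fun _ : Fin n ↦ (PMF.uniformOfFintype Bool).toMeasure) ⊗ₘ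
    Kernel.ofFunOfCountable fun s ↦ independentEdges (edgeProb p q s)

/-- The probability `c / n`. It is truncated to `[0, 1]`, which, for `c ≥ 0`, matters only for the
finitely many `n` with `n < c`. -/
def sparseProb (c : ℝ) (n : ℕ) : I := Set.projIcc 0 1 zero_le_one (c / n)

/-- The law of the unlabelled graph under the planted bisection model with edge probabilities
`a / n` and `b / n`. -/
def sparsePlanted (a b : ℝ) (n : ℕ) : Measure (SimpleGraph (Fin n)) :=
  (plantedBisection n (sparseProb a n) (sparseProb b n)).snd

/-- The Erdős–Rényi model on `Fin n` with edge probability `c / n`. -/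
def sparseErdosRenyi (c : ℝ) (n : ℕ) : Measure (SimpleGraph (Fin n)) :=
  SimpleGraph.binomialRandom (Fin n) (sparseProb c n)

/-- Mutual contiguity of two sequences of measures: the same sequences of events have probabilities
tending to zero. -/
def MutuallyContiguous {Ω : ℕ → Type} [∀ n, MeasurableSpace (Ω n)] (P Q : ∀ n, Measure (Ω n)) :
    Prop :=
  ∀ A : ∀ n, Set (Ω n), (∀ n, MeasurableSet (A n)) →
    (Tendsto (fun n ↦ P n (A n)) atTop (𝓝 0) ↔ Tendsto (fun n ↦ Q n (A n)) atTop (𝓝 0))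

/-- `T` is a consistent estimator of the functional `f` of the parameters `(a, b)` on the parameter
set `Θ`: whenever the graph comes from the planted bisection model with parameters `θ ∈ Θ`, the
estimate `T n G`, which depends on the unlabelled graph only, tends to `f θ` in probability. -/
def IsConsistentEstimator (Θ : Set (ℝ × ℝ)) (f : ℝ × ℝ → ℝ)
    (T : ∀ n, SimpleGraph (Fin n) → ℝ) : Prop :=
  ∀ θ ∈ Θ, ∀ ε : ℝ, 0 < ε →
    Tendsto (fun n ↦ sparsePlanted θ.1 θ.2 n {G | ε < |T n G - f θ|}) atTop (𝓝 0)

/-- The pairs `(a, b)` with `a > b > 0` and `(a - b)² < 2 (a + b)`. -/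
def subcritical : Set (ℝ × ℝ) :=
  {θ | 0 < θ.2 ∧ θ.2 < θ.1 ∧ (θ.1 - θ.2) ^ 2 < 2 * (θ.1 + θ.2)}

end

end BlockModel

namespace BlockModel

noncomputable section

/-! With `d = (a + b) / 2` and `ε = (a - b) / (a + b)`, the planted law P is a uniform mixture over
labellings `s` of independent edges with probabilities `d / n * (1 + ε * edgeSign e s)`, the
Erdős–Rényi law Q is the case `ε = 0`, and the hypothesis reads `d * ε ^ 2 < 1`.

If Q(A) → 0, then P(A) → 0 by Cauchy–Schwarz, because dP/dQ is bounded in L²(Q). Its second moment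
is at most an exponential moment of the overlap of two independent labellings, a Curie–Weiss sum
that stays bounded below the critical point (`sum_coupledWeight_edgeSign_le`).

Conversely, it suffices that the relative entropy -E_Q log(dP/dQ) is bounded (`sum_mul_log_inv_le`),
that is, up to O(1), that the quenched free energy of a diluted spin system is bounded below. This
is done by quadratic replica coupling, without any cycle counts. The derivative of the free energy
in the edge density is controlled by the replica overlap. Jensen's inequality bounds that overlap by
the free energy of two replicas coupled with strength `l / n`, where `d * ε ^ 2 < l < 1`, and the
coupled free energy is bounded by the same exponential moment. Grönwall's inequality on an interval
of length `d / n` closes the loop (`le_freeEnergy`).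

Non-estimability follows: two parameters with equal sum are contiguous to the same Q, so no
statistic can separate them. -/

/-- The point masses of a Bernoulli law on `Bool` with parameter `q`. -/
def bern (q : ℝ) (c : Bool) : ℝ := if c then q else 1 - q

/-- The expectation of `F` over independent Bernoulli variables with parameter `q`. -/
def bernMean {E : Type*} [Fintype E] [DecidableEq E] (q : ℝ) (F : (E → Bool) → ℝ) : ℝ :=
  ∑ x : E → Bool, (∏ e, bern q (x e)) * F x

/-! ### Calculus on the biased cube -/

section BernMean

variable {E : Type*} [Fintype E] [DecidableEq E] {q : ℝ}

lemma bern_nonneg (h0 : 0 ≤ q) (h1 : q ≤ 1) (c : Bool) : 0 ≤ bern q c := by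
  unfold bern; split_ifs <;> linarith

omit [DecidableEq E] in
lemma prod_bern_nonneg (h0 : 0 ≤ q) (h1 : q ≤ 1) (x : E → Bool) : 0 ≤ ∏ e, bern q (x e) :=
  Finset.prod_nonneg fun e _ ↦ bern_nonneg h0 h1 (x e)

lemma sum_prod_apply (f : E → Bool → ℝ) :
    ∑ x : E → Bool, ∏ e, f e (x e) = ∏ e, (f e true + f e false) := by
  have := (Finset.prod_univ_sum (fun _ : E ↦ (Finset.univ : Finset Bool)) f).symm
  rw [Fintype.piFinset_univ] at this
  simpa only [Fintype.sum_bool] using this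

lemma sum_prod_bern : ∑ x : E → Bool, ∏ e, bern q (x e) = 1 := by
  rw [sum_prod_apply (fun _ ↦ bern q)]; simp [bern]

lemma bernMean_const (c : ℝ) : bernMean q (fun _ : E → Bool ↦ c) = c := by
  simp [bernMean, ← Finset.sum_mul, sum_prod_bern]

lemma bernMean_add (F G : (E → Bool) → ℝ) :
    bernMean q (fun x ↦ F x + G x) = bernMean q F + bernMean q G := by
  simp [bernMean, mul_add, Finset.sum_add_distrib]

lemma bernMean_const_mul (c : ℝ) (F : (E → Bool) → ℝ) :
    bernMean q (fun x ↦ c * F x) = c * bernMean q F := by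
  simp only [bernMean, Finset.mul_sum]
  exact Finset.sum_congr rfl fun x _ ↦ by ring

lemma bernMean_sum {ι : Type*} (s : Finset ι) (F : ι → (E → Bool) → ℝ) :
    bernMean q (fun x ↦ ∑ i ∈ s, F i x) = ∑ i ∈ s, bernMean q (F i) := by
  simp only [bernMean, Finset.mul_sum]
  exact Finset.sum_comm

lemma bernMean_mono (h0 : 0 ≤ q) (h1 : q ≤ 1) {F G : (E → Bool) → ℝ} (h : ∀ x, F x ≤ G x) :
    bernMean q F ≤ bernMean q G :=
  Finset.sum_le_sum fun x _ ↦ mul_le_mul_of_nonneg_left (h x) (prod_bern_nonneg h0 h1 x)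

lemma bernMean_indicator (e : E) :
    bernMean q (fun x ↦ if x e then (1 : ℝ) else 0) = q := by
  have : ∀ x : E → Bool, (∏ e', bern q (x e')) * (if x e then (1 : ℝ) else 0)
      = ∏ e', (if e' = e then (if x e' then q else 0) else bern q (x e')) := by
    intro x
    rw [← Finset.mul_prod_erase _ _ (Finset.mem_univ e),
      ← Finset.mul_prod_erase (Finset.univ) (fun e' ↦ if e' = e then _ else _) (Finset.mem_univ e)]
    rw [Finset.prod_congr rfl (g := fun e' ↦ bern q (x e'))
      (fun e' he' ↦ if_neg (Finset.ne_of_mem_erase he'))]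
    by_cases h : x e <;> simp [h, bern]
  unfold bernMean
  rw [Finset.sum_congr rfl fun x _ ↦ this x,
    sum_prod_apply (fun e' c ↦ if e' = e then (if c then q else 0) else bern q c),
    Finset.prod_eq_single e]
  · simp
  · intro b _ hb; simp [hb, bern]
  · simp

lemma bernMean_card (q : ℝ) :
    bernMean q (fun x : E → Bool ↦ ∑ e, if x e then (1 : ℝ) else 0) = Fintype.card E * q := by
  rw [bernMean_sum]; simp [bernMean_indicator]

/-- Resampling one coordinate preserves sums over the cube. -/
lemma sum_eq_sum_update (q : ℝ) (e : E) (G : (E → Bool) → ℝ) :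
    ∑ x, G x = ∑ x : E → Bool, bern q (x e) *
      (G (Function.update x e true) + G (Function.update x e false)) := by
  -- The involution swaps the coordinate at `e` with an auxiliary bit of law `bern q`.
  let f : (E → Bool) × Bool → (E → Bool) × Bool := fun z ↦ (Function.update z.1 e z.2, z.1 e)
  have hf : Function.Involutive f := by
    rintro ⟨x, c⟩; simp [f]
  have h1 := Equiv.sum_comp hf.toPerm (fun z : (E → Bool) × Bool ↦ bern q z.2 * G z.1)
  simp only [Function.Involutive.coe_toPerm, f, Fintype.sum_prod_type, Fintype.sum_bool] at h1
  have h2 : ∀ x, G x = bern q true * G x + bern q false * G x := by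
    intro x; simp [bern]; ring
  rw [Finset.sum_congr rfl fun x _ ↦ h2 x, ← h1]
  exact Finset.sum_congr rfl fun x _ ↦ by ring

lemma hasDerivAt_bern (c : Bool) (q : ℝ) :
    HasDerivAt (fun q ↦ bern q c) (if c then 1 else -1) q := by
  cases c
  · simpa [bern] using (hasDerivAt_id q).const_sub 1
  · simpa [bern] using hasDerivAt_id' q

/-- The Margulis–Russo formula for a function that may depend on the parameter. -/
lemma hasDerivAt_bernMean (F : ℝ → (E → Bool) → ℝ) (F' : (E → Bool) → ℝ) (q : ℝ)
    (hF : ∀ x, HasDerivAt (fun q ↦ F q x) (F' x) q) :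
    HasDerivAt (fun q ↦ bernMean q (F q))
      (∑ e, bernMean q (fun x ↦ F q (Function.update x e true) - F q (Function.update x e false))
        + bernMean q F') q := by
  have h1 : ∀ x : E → Bool, HasDerivAt (fun q ↦ (∏ e, bern q (x e)) * F q x)
      ((∑ e, (∏ e' ∈ Finset.univ.erase e, bern q (x e')) * (if x e then 1 else -1)) * F q x
        + (∏ e, bern q (x e)) * F' x) q := fun x ↦
    (HasDerivAt.fun_finsetProd (fun e _ ↦ hasDerivAt_bern (x e) q)).mul (hF x)
  refine (HasDerivAt.fun_sum fun x _ ↦ h1 x).congr_deriv ?_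
  rw [Finset.sum_add_distrib]
  congr 1
  simp only [Finset.sum_mul]
  rw [Finset.sum_comm]
  refine Finset.sum_congr rfl fun e _ ↦ ?_
  -- Differentiating the factor at `e` leaves a sign ±1 in place of its weight; resampling restores
  -- the weight and turns the sign into a discrete difference.
  rw [sum_eq_sum_update q e]
  refine Finset.sum_congr rfl fun x _ ↦ ?_
  have h2 : ∀ c, ∏ e' ∈ Finset.univ.erase e, bern q (Function.update x e c e')
      = ∏ e' ∈ Finset.univ.erase e, bern q (x e') := fun c ↦
    Finset.prod_congr rfl fun e' he' ↦ by
      rw [Function.update_of_ne (Finset.ne_of_mem_erase he')]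
  simp only [h2]
  rw [← Finset.mul_prod_erase _ _ (Finset.mem_univ e)]
  simp
  ring

end BernMean

/-! ### Gibbs averages and the derivative of the free energy -/

section Gibbs

variable {E R : Type*} [Fintype E] [Fintype R]

/-- The compensated weight of the state `r` when the edges `x` are present: every present edge
contributes the factor `1 + u e r`, and the mean contribution is divided out. -/
def gibbsWeight (w : R → ℝ) (u : E → R → ℝ) (q : ℝ) (x : E → Bool) (r : R) : ℝ :=
  w r * Real.exp (-q * ∑ e, u e r) * ∏ e, if x e then 1 + u e r else 1

/-- The partition function of `gibbsWeight`. -/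
def partitionFn (w : R → ℝ) (u : E → R → ℝ) (q : ℝ) (x : E → Bool) : ℝ :=
  ∑ r, gibbsWeight w u q x r

/-- The average of `f` under the Gibbs measure with weights `gibbsWeight`. -/
def gibbsMean (w : R → ℝ) (u : E → R → ℝ) (q : ℝ) (x : E → Bool) (f : R → ℝ) : ℝ :=
  (∑ r, gibbsWeight w u q x r * f r) / partitionFn w u q x

/-- The quenched free energy of `gibbsWeight`. -/
def freeEnergy [DecidableEq E] (w : R → ℝ) (u : E → R → ℝ) (q : ℝ) : ℝ :=
  bernMean q fun x ↦ Real.log (partitionFn w u q x)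

variable {w : R → ℝ} {u : E → R → ℝ} {q : ℝ} {x : E → Bool}

omit [Fintype R] in
lemma gibbsWeight_pos (hw : ∀ r, 0 < w r) (hu : ∀ e r, -1 < u e r) (r : R) :
    0 < gibbsWeight w u q x r := by
  refine mul_pos (mul_pos (hw r) (Real.exp_pos _)) (Finset.prod_pos fun e _ ↦ ?_)
  split_ifs
  · linarith [hu e r]
  · exact one_pos

lemma partitionFn_pos [Nonempty R] (hw : ∀ r, 0 < w r) (hu : ∀ e r, -1 < u e r) :
    0 < partitionFn w u q x :=
  Finset.sum_pos (fun r _ ↦ gibbsWeight_pos hw hu r) Finset.univ_nonempty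

lemma gibbsMean_add (f g : R → ℝ) :
    gibbsMean w u q x (fun r ↦ f r + g r) = gibbsMean w u q x f + gibbsMean w u q x g := by
  simp [gibbsMean, mul_add, Finset.sum_add_distrib, add_div]

lemma gibbsMean_const_mul (c : ℝ) (f : R → ℝ) :
    gibbsMean w u q x (fun r ↦ c * f r) = c * gibbsMean w u q x f := by
  simp only [gibbsMean, Finset.mul_sum, mul_div_assoc', mul_left_comm]

lemma gibbsMean_sum {ι : Type*} (s : Finset ι) (f : ι → R → ℝ) :
    gibbsMean w u q x (fun r ↦ ∑ i ∈ s, f i r) = ∑ i ∈ s, gibbsMean w u q x (f i) := by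
  simp only [gibbsMean, Finset.mul_sum, ← Finset.sum_div]
  rw [Finset.sum_comm]

lemma gibbsMean_neg (f : R → ℝ) :
    gibbsMean w u q x (fun r ↦ -f r) = -gibbsMean w u q x f := by
  simp [gibbsMean, neg_div]

lemma gibbsMean_one [Nonempty R] (hw : ∀ r, 0 < w r) (hu : ∀ e r, -1 < u e r) :
    gibbsMean w u q x (fun _ ↦ 1) = 1 := by
  simp only [gibbsMean, mul_one]
  exact div_self (partitionFn_pos hw hu).ne'

lemma gibbsMean_mono [Nonempty R] (hw : ∀ r, 0 < w r) (hu : ∀ e r, -1 < u e r) {f g : R → ℝ}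
    (h : ∀ r, f r ≤ g r) : gibbsMean w u q x f ≤ gibbsMean w u q x g :=
  div_le_div_of_nonneg_right (Finset.sum_le_sum fun r _ ↦
    mul_le_mul_of_nonneg_left (h r) (gibbsWeight_pos hw hu r).le) (partitionFn_pos hw hu).le

lemma abs_gibbsMean_le [Nonempty R] (hw : ∀ r, 0 < w r) (hu : ∀ e r, -1 < u e r) {f : R → ℝ}
    {K : ℝ} (h : ∀ r, |f r| ≤ K) : |gibbsMean w u q x f| ≤ K := by
  have hc : ∀ c : ℝ, gibbsMean w u q x (fun _ ↦ c) = c := fun c ↦ by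
    simpa [gibbsMean_one hw hu] using
      gibbsMean_const_mul (w := w) (u := u) (q := q) (x := x) c (fun _ ↦ 1)
  rw [abs_le]
  constructor
  · rw [← hc (-K)]
    exact gibbsMean_mono hw hu fun r ↦ (abs_le.1 (h r)).1
  · rw [← hc K]
    exact gibbsMean_mono hw hu fun r ↦ (abs_le.1 (h r)).2

variable [DecidableEq E]

omit [Fintype R] in
lemma gibbsWeight_update_true (e : E) (r : R) :
    gibbsWeight w u q (Function.update x e true) r
      = gibbsWeight w u q (Function.update x e false) r * (1 + u e r) := by
  unfold gibbsWeight
  have h : ∀ c, ∏ e' ∈ Finset.univ.erase e, (if Function.update x e c e' then 1 + u e' r else 1)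
      = ∏ e' ∈ Finset.univ.erase e, (if x e' then 1 + u e' r else 1) := fun c ↦
    Finset.prod_congr rfl fun e' he' ↦ by
      rw [Function.update_of_ne (Finset.ne_of_mem_erase he')]
  rw [← Finset.mul_prod_erase _ _ (Finset.mem_univ e),
    ← Finset.mul_prod_erase Finset.univ (fun e' ↦ if Function.update x e false e' then _ else _)
      (Finset.mem_univ e), h, h]
  simp
  ring

lemma log_partitionFn_update [Nonempty R] (hw : ∀ r, 0 < w r) (hu : ∀ e r, -1 < u e r) (e : E) :
    Real.log (partitionFn w u q (Function.update x e true))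
        - Real.log (partitionFn w u q (Function.update x e false))
      = Real.log (1 + gibbsMean w u q (Function.update x e false) (u e)) := by
  have hZ := partitionFn_pos (q := q) (x := Function.update x e false) hw hu
  rw [← Real.log_div (partitionFn_pos hw hu).ne' hZ.ne']
  congr 1
  rw [gibbsMean, div_eq_iff hZ.ne', add_mul, div_mul_cancel₀ _ hZ.ne', partitionFn, partitionFn]
  simp only [gibbsWeight_update_true, mul_add, Finset.sum_add_distrib, mul_one, one_mul, add_comm]

/-- Removing `e` matters only if `e` is present, which has probability `q`. Summed over edges and
integrated over `q` up to `d / N`, a crude bound there costs only O(1). -/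
lemma abs_gibbsMean_update_sub_le [Nonempty R] (hw : ∀ r, 0 < w r) (hu : ∀ e r, -1 < u e r)
    {f : R → ℝ} {K : ℝ} (h : ∀ r, |f r| ≤ K) (e : E) :
    |gibbsMean w u q (Function.update x e false) f - gibbsMean w u q x f|
      ≤ 2 * K * (if x e then 1 else 0) := by
  by_cases hx : x e
  · rw [if_pos hx]
    refine (abs_sub _ _).trans ?_
    linarith [abs_gibbsMean_le (q := q) (x := x) hw hu h,
      abs_gibbsMean_le (q := q) (x := Function.update x e false) hw hu h]
  · have : Function.update x e false = x := by
      rw [Function.update_eq_self_iff]; simpa using (Eq.symm (by simpa using hx))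
    simp [this, hx]

omit [Fintype R] [DecidableEq E] in
lemma hasDerivAt_gibbsWeight (r : R) :
    HasDerivAt (fun q ↦ gibbsWeight w u q x r) (gibbsWeight w u q x r * -∑ e, u e r) q := by
  have h := ((((hasDerivAt_id' q).neg.mul_const (∑ e, u e r)).exp.const_mul (w r)).mul_const
    (∏ e, if x e then 1 + u e r else 1))
  refine h.congr_deriv ?_
  simp only [gibbsWeight, Pi.neg_apply]
  ring

omit [DecidableEq E] in
lemma hasDerivAt_log_partitionFn [Nonempty R] (hw : ∀ r, 0 < w r) (hu : ∀ e r, -1 < u e r) :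
    HasDerivAt (fun q ↦ Real.log (partitionFn w u q x)) (-∑ e, gibbsMean w u q x (u e)) q := by
  have h := (HasDerivAt.fun_sum fun r (_ : r ∈ Finset.univ) ↦
    hasDerivAt_gibbsWeight (w := w) (u := u) (q := q) (x := x) r).log
      (partitionFn_pos (q := q) (x := x) hw hu).ne'
  refine h.congr_deriv ?_
  rw [← gibbsMean_sum, ← gibbsMean_neg]
  rfl

/-- Margulis–Russo yields the logarithm, the compensating exponential the subtracted mean. To first
order they cancel, so the derivative is governed by squared Gibbs means. -/
lemma hasDerivAt_freeEnergy [Nonempty R] (hw : ∀ r, 0 < w r) (hu : ∀ e r, -1 < u e r) (q : ℝ) :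
    HasDerivAt (freeEnergy w u)
      (bernMean q fun x ↦ ∑ e, (Real.log (1 + gibbsMean w u q (Function.update x e false) (u e))
        - gibbsMean w u q x (u e))) q := by
  have h := hasDerivAt_bernMean (fun q x ↦ Real.log (partitionFn w u q x)) _ q
    fun x ↦ hasDerivAt_log_partitionFn (q := q) (x := x) hw hu
  refine h.congr_deriv ?_
  rw [← bernMean_sum, ← bernMean_add]
  congr 1
  ext x
  rw [Finset.sum_congr rfl fun e _ ↦ log_partitionFn_update hw hu e, ← sub_eq_add_neg,
    Finset.sum_sub_distrib]

lemma freeEnergy_zero (w : R → ℝ) (u : E → R → ℝ) : freeEnergy w u 0 = Real.log (∑ r, w r) := by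
  have h : ∀ x : E → Bool, (∏ e, bern 0 (x e)) * Real.log (partitionFn w u 0 x)
      = (∏ e, bern 0 (x e)) * Real.log (∑ r, w r) := by
    intro x
    by_cases hx : ∃ e, x e = true
    · obtain ⟨e, he⟩ := hx
      rw [Finset.prod_eq_zero (Finset.mem_univ e) (by simp [bern, he])]
      simp
    · push Not at hx
      congr 2
      simp [partitionFn, gibbsWeight, hx]
  unfold freeEnergy bernMean
  rw [Finset.sum_congr rfl fun x _ ↦ h x]
  exact bernMean_const (E := E) (q := 0) _

lemma deriv_freeEnergy_le [Nonempty R] (hw : ∀ r, 0 < w r) (hu : ∀ e r, -1 < u e r) {K : ℝ}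
    (hK : ∀ e r, |u e r| ≤ K) (h0 : 0 ≤ q) (h1 : q ≤ 1) :
    (bernMean q fun x ↦ ∑ e, (Real.log (1 + gibbsMean w u q (Function.update x e false) (u e))
        - gibbsMean w u q x (u e))) ≤ 2 * K * (Fintype.card E * q) := by
  rw [← bernMean_card (E := E), ← bernMean_const_mul]
  refine bernMean_mono h0 h1 fun x ↦ ?_
  rw [Finset.mul_sum]
  refine Finset.sum_le_sum fun e _ ↦ ?_
  have h2 : 0 < 1 + gibbsMean w u q (Function.update x e false) (u e) := by
    rw [← gibbsMean_one (q := q) (x := Function.update x e false) hw hu, ← gibbsMean_add]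
    refine div_pos (Finset.sum_pos (fun r _ ↦ mul_pos (gibbsWeight_pos hw hu r) ?_)
      Finset.univ_nonempty) (partitionFn_pos hw hu)
    linarith [hu e r]
  have h3 := Real.log_le_sub_one_of_pos h2
  have h4 := abs_le.1 (abs_gibbsMean_update_sub_le (q := q) (x := x) hw hu (hK e) e)
  linarith [h4.2]

lemma sub_sq_div_le_log {m κ : ℝ} (hκ : κ < 1) (hm : |m| ≤ κ) :
    m - m ^ 2 / (1 - κ) ≤ Real.log (1 + m) := by
  have h1 : 0 < 1 - κ := by linarith
  have h2 : 1 - κ ≤ 1 + m := by linarith [neg_abs_le m]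
  have h3 : 0 < 1 + m := by linarith
  have h4 := Real.one_sub_inv_le_log_of_pos h3
  have h5 : m ^ 2 / (1 + m) ≤ m ^ 2 / (1 - κ) := by gcongr
  have h6 : 1 - (1 + m)⁻¹ = m - m ^ 2 / (1 + m) := by field_simp; ring
  linarith

/-- On absent edges the two Gibbs means agree and only the quadratic error of the logarithm remains;
on present edges every error is absorbed in `4 / (1 - K)`. -/
lemma le_deriv_freeEnergy [Nonempty R] (hw : ∀ r, 0 < w r) {K : ℝ} (hK1 : K < 1)
    (hK : ∀ e r, |u e r| ≤ K) (h0 : 0 ≤ q) (h1 : q ≤ 1) :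
    -(4 / (1 - K)) * (Fintype.card E * q)
        - 1 / (1 - K) * bernMean q (fun x ↦ ∑ e, gibbsMean w u q x (u e) ^ 2) ≤
      bernMean q fun x ↦ ∑ e, (Real.log (1 + gibbsMean w u q (Function.update x e false) (u e))
        - gibbsMean w u q x (u e)) := by
  have hu : ∀ e r, -1 < u e r := fun e r ↦ by linarith [(abs_le.1 (hK e r)).1]
  have hL : 0 < 1 - K := by linarith
  rw [← bernMean_card (E := E), sub_eq_add_neg, ← neg_mul, ← bernMean_const_mul,
    ← bernMean_const_mul, ← bernMean_add]
  refine bernMean_mono h0 h1 fun x ↦ ?_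
  rw [Finset.mul_sum, Finset.mul_sum, ← Finset.sum_add_distrib]
  refine Finset.sum_le_sum fun e _ ↦ ?_
  set m := gibbsMean w u q x (u e) with hm
  set m' := gibbsMean w u q (Function.update x e false) (u e) with hm'
  have a1 : |m'| ≤ K := abs_gibbsMean_le hw hu (hK e)
  have a2 : |m| ≤ K := abs_gibbsMean_le hw hu (hK e)
  have a3 := sub_sq_div_le_log hK1 a1
  have a4 := abs_gibbsMean_update_sub_le (q := q) (x := x) hw hu (hK e) e
  have hK0 : 0 ≤ K := (abs_nonneg _).trans a1
  rw [← hm, ← hm'] at a4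
  have a5 : 1 ≤ 1 / (1 - K) := by rw [le_div_iff₀ hL]; linarith
  by_cases hx : x e
  · simp only [hx, if_true] at a4 ⊢
    have b1 : m' ^ 2 ≤ 1 := by nlinarith [abs_nonneg m', sq_abs m']
    have b2 : m' ^ 2 / (1 - K) ≤ 1 / (1 - K) := by gcongr
    have b3 : 0 ≤ 1 / (1 - K) * m ^ 2 := by positivity
    have b4 : (4 : ℝ) / (1 - K) = 4 * (1 / (1 - K)) := by ring
    rw [b4]
    linarith [(abs_le.1 a4).1]
  · simp only [hx] at a4 ⊢
    have : m' = m := by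
      have : |m' - m| ≤ 0 := by simpa using a4
      linarith [abs_le.1 this]
    rw [this] at a3 ⊢
    simp
    have b4 : m ^ 2 / (1 - K) = (1 - K)⁻¹ * m ^ 2 := by ring
    linarith

end Gibbs

/-! ### Quadratic replica coupling -/

section Coupling

variable {E S : Type*} [Fintype E] [Fintype S]

/-- The overlap of two configurations. -/
def overlap (χ : E → S → ℝ) (z : S × S) : ℝ := ∑ e, χ e z.1 * χ e z.2

/-- The uniform weight. -/
def uniformWeight (S : Type*) [Fintype S] (_ : S) : ℝ := (Fintype.card S : ℝ)⁻¹

/-- The uniform weight on pairs of configurations, tilted by the overlap. -/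
def coupledWeight (χ : E → S → ℝ) (θ : ℝ) (z : S × S) : ℝ :=
  uniformWeight S z.1 * uniformWeight S z.2 * Real.exp (θ * overlap χ z)

/-- The interaction of two replicas: `1 + coupledInteraction = (1 + ε χ) (1 + ε χ)`. -/
def coupledInteraction (χ : E → S → ℝ) (ε : ℝ) (e : E) (z : S × S) : ℝ :=
  ε * (χ e z.1 + χ e z.2) + ε ^ 2 * (χ e z.1 * χ e z.2)

variable {χ : E → S → ℝ} {ε θ q : ℝ}

lemma uniformWeight_pos [Nonempty S] (s : S) : 0 < uniformWeight S s := by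
  have : 0 < Fintype.card S := Fintype.card_pos
  unfold uniformWeight; positivity

lemma sum_uniformWeight [Nonempty S] : ∑ s : S, uniformWeight S s = 1 := by
  have : (Fintype.card S : ℝ) ≠ 0 := by exact_mod_cast Fintype.card_ne_zero
  simp [uniformWeight, this]

lemma coupledWeight_pos [Nonempty S] (z : S × S) : 0 < coupledWeight χ θ z :=
  mul_pos (mul_pos (uniformWeight_pos _) (uniformWeight_pos _)) (Real.exp_pos _)

omit [Fintype E] [Fintype S] in
lemma abs_mul_le_of_abs_le_one (h0 : 0 ≤ ε) (hχ : ∀ e s, |χ e s| ≤ 1) (e : E) (s : S) :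
    |ε * χ e s| ≤ ε := by
  rw [abs_mul, abs_of_nonneg h0]
  exact mul_le_of_le_one_right h0 (hχ e s)

omit [Fintype E] [Fintype S] in
lemma neg_one_lt_coupledInteraction (h0 : 0 ≤ ε) (h1 : ε < 1) (hχ : ∀ e s, |χ e s| ≤ 1) (e : E)
    (z : S × S) : -1 < coupledInteraction χ ε e z := by
  have a := (abs_le.1 (abs_mul_le_of_abs_le_one h0 hχ e z.1)).1
  have b := (abs_le.1 (abs_mul_le_of_abs_le_one h0 hχ e z.2)).1
  have : 0 < (1 + ε * χ e z.1) * (1 + ε * χ e z.2) := by apply mul_pos <;> linarith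
  unfold coupledInteraction
  nlinarith

omit [Fintype E] [Fintype S] in
lemma abs_coupledInteraction_le (h0 : 0 ≤ ε) (h1 : ε < 1) (hχ : ∀ e s, |χ e s| ≤ 1) (e : E)
    (z : S × S) : |coupledInteraction χ ε e z| ≤ 3 := by
  have a := abs_mul_le_of_abs_le_one h0 hχ e z.1
  have b := abs_mul_le_of_abs_le_one h0 hχ e z.2
  have h : coupledInteraction χ ε e z
      = ε * χ e z.1 + ε * χ e z.2 + (ε * χ e z.1) * (ε * χ e z.2) := by
    unfold coupledInteraction; ring
  have c : |(ε * χ e z.1) * (ε * χ e z.2)| ≤ 1 := by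
    rw [abs_mul]
    exact mul_le_one₀ (by linarith) (abs_nonneg _) (by linarith)
  rw [h]
  refine (abs_add_le _ _).trans ?_
  linarith [abs_add_le (ε * χ e z.1) (ε * χ e z.2)]

/-- The edge factors split between the replicas, but the compensations differ by `q * ε ^ 2` times
the overlap: the system is two independent replicas with tilt `θ - q * ε ^ 2`. -/
lemma gibbsWeight_coupled (x : E → Bool) (z : S × S) :
    gibbsWeight (coupledWeight χ θ) (coupledInteraction χ ε) q x z
      = gibbsWeight (uniformWeight S) (fun e s ↦ ε * χ e s) q x z.1
        * gibbsWeight (uniformWeight S) (fun e s ↦ ε * χ e s) q x z.2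
        * Real.exp ((θ - q * ε ^ 2) * overlap χ z) := by
  have h1 : ∏ e, (if x e then 1 + coupledInteraction χ ε e z else 1)
      = (∏ e, if x e then 1 + ε * χ e z.1 else 1) * ∏ e, if x e then 1 + ε * χ e z.2 else 1 := by
    rw [← Finset.prod_mul_distrib]
    refine Finset.prod_congr rfl fun e _ ↦ ?_
    split_ifs
    · unfold coupledInteraction; ring
    · ring
  have h2 : ∑ e, coupledInteraction χ ε e z
      = ∑ e, ε * χ e z.1 + ∑ e, ε * χ e z.2 + ε ^ 2 * overlap χ z := by
    simp only [coupledInteraction, overlap, Finset.mul_sum, ← Finset.sum_add_distrib]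
    exact Finset.sum_congr rfl fun e _ ↦ by ring
  have h3 : Real.exp (θ * overlap χ z) * Real.exp (-q * ∑ e, coupledInteraction χ ε e z)
      = Real.exp (-q * ∑ e, ε * χ e z.1) * Real.exp (-q * ∑ e, ε * χ e z.2)
        * Real.exp ((θ - q * ε ^ 2) * overlap χ z) := by
    rw [← Real.exp_add, ← Real.exp_add, ← Real.exp_add, h2]
    congr 1; ring
  unfold gibbsWeight coupledWeight
  rw [h1]
  linear_combination (uniformWeight S z.1 * uniformWeight S z.2 *
    (∏ e, if x e then 1 + ε * χ e z.1 else 1) * ∏ e, if x e then 1 + ε * χ e z.2 else 1) * h3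

/-- Jensen's inequality for the coupled partition function. -/
lemma le_log_partitionFn_coupled [Nonempty S] (h0 : 0 ≤ ε) (h1 : ε < 1)
    (hχ : ∀ e s, |χ e s| ≤ 1) (x : E → Bool) :
    2 * Real.log (partitionFn (uniformWeight S) (fun e s ↦ ε * χ e s) q x)
        + (θ - q * ε ^ 2) *
          ∑ e, gibbsMean (uniformWeight S) (fun e s ↦ ε * χ e s) q x (χ e) ^ 2
      ≤ Real.log (partitionFn (coupledWeight χ θ) (coupledInteraction χ ε) q x) := by
  have hu : ∀ e (s : S), -1 < ε * χ e s := fun e s ↦ by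
    linarith [(abs_le.1 (abs_mul_le_of_abs_le_one h0 hχ e s)).1]
  set W := gibbsWeight (uniformWeight S) (fun e s ↦ ε * χ e s) q x with hW
  set Z := partitionFn (uniformWeight S) (fun e s ↦ ε * χ e s) q x with hZ
  have hZpos : 0 < Z := partitionFn_pos uniformWeight_pos hu
  have hWpos : ∀ s, 0 < W s := gibbsWeight_pos uniformWeight_pos hu
  have hZW : ∑ s, W s = Z := rfl
  set c := θ - q * ε ^ 2
  set J := ∑ e, gibbsMean (uniformWeight S) (fun e s ↦ ε * χ e s) q x (χ e) ^ 2 with hJ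
  have hsum : ∑ z : S × S, W z.1 * W z.2 / Z ^ 2 = 1 := by
    rw [← Finset.sum_div, Fintype.sum_prod_type]
    simp only [← Finset.mul_sum, ← Finset.sum_mul, hZW]
    rw [← sq, div_self (by positivity)]
  -- Under the product of two Gibbs measures the mean overlap factorises into squared Gibbs means.
  have hQ : ∑ z : S × S, W z.1 * W z.2 / Z ^ 2 * (c * overlap χ z) = c * J := by
    have : ∀ z : S × S, W z.1 * W z.2 / Z ^ 2 * (c * overlap χ z)
        = ∑ e, c * ((W z.1 * χ e z.1) / Z * ((W z.2 * χ e z.2) / Z)) := by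
      intro z
      simp only [overlap, Finset.mul_sum]
      exact Finset.sum_congr rfl fun e _ ↦ by field_simp
    rw [Finset.sum_congr rfl fun z _ ↦ this z, Finset.sum_comm, hJ, Finset.mul_sum]
    refine Finset.sum_congr rfl fun e _ ↦ ?_
    rw [← Finset.mul_sum, Fintype.sum_prod_type]
    simp only [← Finset.mul_sum, ← Finset.sum_mul, ← Finset.sum_div]
    rw [← sq]; rfl
  have hjensen := convexOn_exp.map_sum_le (t := (Finset.univ : Finset (S × S)))
    (w := fun z ↦ W z.1 * W z.2 / Z ^ 2) (p := fun z ↦ c * overlap χ z)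
    (fun z _ ↦ div_nonneg (mul_nonneg (hWpos _).le (hWpos _).le) (by positivity)) hsum
    (fun _ _ ↦ Set.mem_univ _)
  simp only [smul_eq_mul] at hjensen
  rw [hQ] at hjensen
  have hP : partitionFn (coupledWeight χ θ) (coupledInteraction χ ε) q x
      = Z ^ 2 * ∑ z : S × S, W z.1 * W z.2 / Z ^ 2 * Real.exp (c * overlap χ z) := by
    rw [Finset.mul_sum]
    refine Finset.sum_congr rfl fun z _ ↦ ?_
    rw [gibbsWeight_coupled]
    change W z.1 * W z.2 * Real.exp (c * overlap χ z) = _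
    field_simp
  rw [hP, ← Real.log_exp (c * J), show (2 : ℝ) * Real.log Z = Real.log (Z ^ 2) by simp,
    ← Real.log_mul (by positivity) (Real.exp_pos _).ne']
  exact Real.log_le_log (by positivity) (by gcongr)

variable [DecidableEq E]

lemma le_freeEnergy_coupled [Nonempty S] (h0 : 0 ≤ ε) (h1 : ε < 1)
    (hχ : ∀ e s, |χ e s| ≤ 1) (hq0 : 0 ≤ q) (hq1 : q ≤ 1) :
    2 * freeEnergy (uniformWeight S) (fun e s ↦ ε * χ e s) q
        + (θ - q * ε ^ 2) * bernMean q (fun x ↦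
          ∑ e, gibbsMean (uniformWeight S) (fun e s ↦ ε * χ e s) q x (χ e) ^ 2)
      ≤ freeEnergy (coupledWeight χ θ) (coupledInteraction χ ε) q := by
  unfold freeEnergy
  rw [← bernMean_const_mul, ← bernMean_const_mul, ← bernMean_add]
  exact bernMean_mono hq0 hq1 fun x ↦ le_log_partitionFn_coupled h0 h1 hχ x

/-- Since log(1 + m) ≤ m, only present edges can raise the free energy. The interaction is bounded
by 3, whence the constant 6; at `q = 0` only the exponential moment of the overlap is left. -/
lemma freeEnergy_coupled_le [Nonempty S] (h0 : 0 ≤ ε) (h1 : ε < 1) (hχ : ∀ e s, |χ e s| ≤ 1)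
    {p : ℝ} (hp : p ≤ 1) (hq : q ∈ Set.Icc 0 p) :
    freeEnergy (coupledWeight χ θ) (coupledInteraction χ ε) q
      ≤ Real.log (∑ z, coupledWeight χ θ z) + 6 * (Fintype.card E * p ^ 2) := by
  have hu := neg_one_lt_coupledInteraction h0 h1 hχ
  have hd := hasDerivAt_freeEnergy (coupledWeight_pos (χ := χ) (θ := θ)) hu
  have hd' := fun q ↦ (hd q).sub ((hasDerivAt_id' q).const_mul (6 * (Fintype.card E * p)))
  have hanti := antitoneOn_of_deriv_nonpos (convex_Icc 0 p)
    (fun q _ ↦ (hd' q).continuousAt.continuousWithinAt)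
    (fun q _ ↦ (hd' q).differentiableAt.differentiableWithinAt) (fun q hq ↦ by
      rw [interior_Icc] at hq
      rw [(hd' q).deriv]
      have h2 := deriv_freeEnergy_le (q := q) (coupledWeight_pos (χ := χ) (θ := θ)) hu
        (abs_coupledInteraction_le h0 h1 hχ) hq.1.le (hq.2.le.trans hp)
      have h3 : (Fintype.card E : ℝ) * q ≤ Fintype.card E * p := by
        gcongr; exact hq.2.le
      linarith)
  have h2 := hanti (Set.left_mem_Icc.2 (hq.1.trans hq.2)) hq hq.1
  simp only [Pi.sub_apply, freeEnergy_zero, mul_zero, sub_zero] at h2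
  have h3 : 6 * (Fintype.card E * p) * q ≤ 6 * (Fintype.card E * p) * p := by
    have := hq.1.trans hq.2
    gcongr; exact hq.2
  linarith

/-- A Grönwall inequality in differential form. -/
lemma le_of_deriv_le_affine {D D' : ℝ → ℝ} {a k N p : ℝ} (hk : 0 < k) (hp : 0 ≤ p)
    (hD : ∀ q, HasDerivAt D (D' q) q)
    (h : ∀ q ∈ Set.Icc 0 p, D' q ≤ N * (a + k * D q)) :
    D p ≤ Real.exp (k * (N * p)) * (D 0 + a / k) - a / k := by
  -- Integrating factor: `exp (-(N * k) * q) * (D q + a / k)` is antitone.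
  have hd := fun q ↦ ((((hasDerivAt_id' q).const_mul (-(N * k))).exp).mul ((hD q).add_const (a / k)))
  have hanti := antitoneOn_of_deriv_nonpos (convex_Icc 0 p)
    (fun q _ ↦ (hd q).continuousAt.continuousWithinAt)
    (fun q _ ↦ (hd q).differentiableAt.differentiableWithinAt) (fun q hq ↦ by
      rw [interior_Icc] at hq
      rw [(hd q).deriv]
      have h1 := h q ⟨hq.1.le, hq.2.le⟩
      have h2 : Real.exp (-(N * k) * q) * (-(N * k) * 1) * (D q + a / k)
          + Real.exp (-(N * k) * q) * D' q
          = Real.exp (-(N * k) * q) * (D' q - N * (a + k * D q)) := by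
        field_simp; ring
      rw [h2]
      exact mul_nonpos_of_nonneg_of_nonpos (Real.exp_pos _).le (by linarith))
  have h1 := hanti (Set.left_mem_Icc.2 hp) (Set.right_mem_Icc.2 hp) hp
  simp only [Pi.mul_apply, mul_zero, Real.exp_zero, one_mul] at h1
  have h2 : D p + a / k
      = Real.exp (k * (N * p)) * (Real.exp (-(N * k) * p) * (D p + a / k)) := by
    rw [← mul_assoc, ← Real.exp_add, show k * (N * p) + -(N * k) * p = 0 by ring]; simp
  have h3 := mul_le_mul_of_nonneg_left h1 (Real.exp_pos (k * (N * p))).le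
  linarith

/-- The constant in the lower bound for the quenched free energy. -/
def freeEnergyBound (ε d δ C : ℝ) : ℝ :=
  (Real.exp (2 * ε ^ 2 / (δ * (1 - ε)) * d) * (C + 6 * d ^ 2 +
      8 * d / (1 - ε) / (2 * ε ^ 2 / (δ * (1 - ε))))
    - (8 * d / (1 - ε) / (2 * ε ^ 2 / (δ * (1 - ε))) + (C + 6 * d ^ 2))) / 2

/-- The quadratic replica coupling bound: the quenched free energy is bounded below whenever the
exponential moment of the overlap is bounded. -/
lemma le_freeEnergy [Nonempty S] (h0 : 0 < ε) (h1 : ε < 1) (hχ : ∀ e s, |χ e s| ≤ 1)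
    {N d l δ C : ℝ} (hN : 0 < N) (hd : 0 ≤ d) (hdN : d / N ≤ 1)
    (hM : (Fintype.card E : ℝ) ≤ N ^ 2) (hδ : 0 < δ) (hl : δ ≤ l - d * ε ^ 2)
    (hC : Real.log (∑ z, coupledWeight χ (l / N) z) ≤ C) :
    -freeEnergyBound ε d δ C ≤ freeEnergy (uniformWeight S) (fun e s ↦ ε * χ e s) (d / N) := by
  set A := freeEnergy (uniformWeight S) (fun e s ↦ ε * χ e s) with hA
  have hL : 0 < 1 - ε := by linarith
  have hp0 : 0 ≤ d / N := by positivity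
  have hu : ∀ e (s : S), -1 < ε * χ e s := fun e s ↦ by
    linarith [(abs_le.1 (abs_mul_le_of_abs_le_one h0.le hχ e s)).1]
  set A' := fun q ↦ (bernMean q fun x ↦ ∑ e, (Real.log (1 + gibbsMean (uniformWeight S)
    (fun e s ↦ ε * χ e s) q (Function.update x e false) (fun s ↦ ε * χ e s))
        - gibbsMean (uniformWeight S) (fun e s ↦ ε * χ e s) q x (fun s ↦ ε * χ e s))) with hA'
  have hAd : ∀ q, HasDerivAt A (A' q) q := hasDerivAt_freeEnergy uniformWeight_pos hu
  have hMp : (Fintype.card E : ℝ) * (d / N) ^ 2 ≤ d ^ 2 := by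
    calc (Fintype.card E : ℝ) * (d / N) ^ 2 ≤ N ^ 2 * (d / N) ^ 2 := by gcongr
      _ = d ^ 2 := by field_simp
  -- Put `D = C + 6 * d ^ 2 - 2 * A`. The surplus tilt `δ / N` bounds the overlap term by `N / δ *
  -- D`, so D' ≤ N(a + kD) with `a`, `k` free of `N`; an interval of length `d / N` then gives a
  -- bound free of `N`.
  have key : ∀ q ∈ Set.Icc 0 (d / N), -2 * A' q ≤
      N * (8 * d / (1 - ε) + 2 * ε ^ 2 / (δ * (1 - ε)) * (C + 6 * d ^ 2 - 2 * A q)) := by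
    intro q hq
    have hq1 := hq.2.trans hdN
    set T := bernMean q (fun x ↦
          ∑ e, gibbsMean (uniformWeight S) (fun e s ↦ ε * χ e s) q x (χ e) ^ 2) with hT
    have hT0 : 0 ≤ T := by
      rw [← bernMean_const (E := E) (q := q) 0]
      exact bernMean_mono hq.1 hq1 fun x ↦ Finset.sum_nonneg fun e _ ↦ sq_nonneg _
    have b1 := freeEnergy_coupled_le (θ := l / N) h0.le h1 hχ hdN hq
    have b2 := le_freeEnergy_coupled (θ := l / N) h0.le h1 hχ hq.1 hq1
    have b3 := le_deriv_freeEnergy (w := uniformWeight S) uniformWeight_pos h1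
      (abs_mul_le_of_abs_le_one h0.le hχ) hq.1 hq1
    rw [← hT, ← hA] at b2
    have b4 : (bernMean q fun x ↦ ∑ e, gibbsMean (uniformWeight S) (fun e s ↦ ε * χ e s) q x
        (fun s ↦ ε * χ e s) ^ 2) = ε ^ 2 * T := by
      rw [hT, ← bernMean_const_mul]
      congr 1; ext x
      rw [Finset.mul_sum]
      refine Finset.sum_congr rfl fun e _ ↦ ?_
      rw [gibbsMean_const_mul, mul_pow]
    have b5 : δ / N ≤ l / N - q * ε ^ 2 := by
      have : q * ε ^ 2 ≤ d / N * ε ^ 2 := by gcongr; exact hq.2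
      have : δ / N ≤ (l - d * ε ^ 2) / N := by gcongr
      have : (l - d * ε ^ 2) / N = l / N - d / N * ε ^ 2 := by ring
      linarith
    have b6 : δ / N * T ≤ C + 6 * d ^ 2 - 2 * A q := by
      have := mul_le_mul_of_nonneg_right b5 hT0
      linarith
    have b7 : ε ^ 2 * T ≤ N * ε ^ 2 / δ * (C + 6 * d ^ 2 - 2 * A q) := by
      calc ε ^ 2 * T = N * ε ^ 2 / δ * (δ / N * T) := by field_simp
        _ ≤ _ := by gcongr
    have b8 : (Fintype.card E : ℝ) * q ≤ d * N := by
      calc (Fintype.card E : ℝ) * q ≤ N ^ 2 * (d / N) := by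
            have := hq.1
            gcongr; exact hq.2
        _ = d * N := by field_simp
    have b9 : -(4 / (1 - ε)) * (Fintype.card E * q) - 1 / (1 - ε) * (ε ^ 2 * T) ≤ A' q := by
      rw [← b4]; exact b3
    have b10 : 4 / (1 - ε) * (Fintype.card E * q) ≤ 4 / (1 - ε) * (d * N) := by gcongr
    have b11 : 1 / (1 - ε) * (ε ^ 2 * T)
        ≤ 1 / (1 - ε) * (N * ε ^ 2 / δ * (C + 6 * d ^ 2 - 2 * A q)) := by gcongr
    have b12 : N * (8 * d / (1 - ε) + 2 * ε ^ 2 / (δ * (1 - ε)) * (C + 6 * d ^ 2 - 2 * A q))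
        = 2 * (4 / (1 - ε) * (d * N))
          + 2 * (1 / (1 - ε) * (N * ε ^ 2 / δ * (C + 6 * d ^ 2 - 2 * A q))) := by
      field_simp; ring
    rw [b12]
    linarith
  have hD : ∀ q, HasDerivAt (fun q ↦ C + 6 * d ^ 2 - 2 * A q) (-2 * A' q) q := fun q ↦
    (((hAd q).const_mul 2).const_sub _).congr_deriv (by ring)
  have hk : 0 < 2 * ε ^ 2 / (δ * (1 - ε)) := by positivity
  have hfin := le_of_deriv_le_affine hk hp0 hD key
  have hA0 : A 0 = 0 := by
    rw [hA, freeEnergy_zero, sum_uniformWeight, Real.log_one]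
  rw [hA0, mul_div_cancel₀ d hN.ne'] at hfin
  unfold freeEnergyBound
  linarith

end Coupling

/-! ### Likelihood ratio: second moment and relative entropy -/

section Likelihood

variable {E S : Type*} [Fintype E] [Fintype S]

/-- The mass of the configuration `x` of edges under the mixture over `s` of independent edges
with probabilities `p (1 + ε χ e s)`. -/
def mixtureMass (χ : E → S → ℝ) (ε p : ℝ) (x : E → Bool) : ℝ :=
  ∑ s, uniformWeight S s * ∏ e, bern (p * (1 + ε * χ e s)) (x e)

variable {χ : E → S → ℝ} {ε p : ℝ}

lemma bern_pos {q : ℝ} (h0 : 0 < q) (h1 : q < 1) (c : Bool) : 0 < bern q c := by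
  unfold bern; split_ifs <;> linarith

lemma mixtureMass_pos [Nonempty S] (hε0 : 0 ≤ ε) (hε1 : ε < 1) (hχ : ∀ e s, |χ e s| ≤ 1)
    (hp0 : 0 < p) (hp1 : p ≤ 1 / 4) (x : E → Bool) : 0 < mixtureMass χ ε p x := by
  refine Finset.sum_pos (fun s _ ↦ mul_pos (uniformWeight_pos s)
    (Finset.prod_pos fun e _ ↦ ?_)) Finset.univ_nonempty
  have h := abs_le.1 (abs_mul_le_of_abs_le_one hε0 hχ e s)
  exact bern_pos (mul_pos hp0 (by linarith)) (by nlinarith) _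

omit [Fintype E] [Fintype S] in
lemma sum_bern_mul_div (hp0 : 0 < p) (hp1 : p ≤ 1 / 4) (a b : ℝ) :
    bern (p * (1 + ε * a)) true * bern (p * (1 + ε * b)) true / bern p true
      + bern (p * (1 + ε * a)) false * bern (p * (1 + ε * b)) false / bern p false
      = 1 + p * ε ^ 2 / (1 - p) * (a * b) := by
  have : 1 - p ≠ 0 := by linarith
  simp only [bern, if_true, Bool.false_eq_true, if_false]
  field_simp
  ring

variable [DecidableEq E]

lemma sum_mixtureMass [Nonempty S] : ∑ x, mixtureMass χ ε p x = 1 := by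
  unfold mixtureMass
  rw [Finset.sum_comm]
  simp only [← Finset.mul_sum]
  have : ∀ s, ∑ x : E → Bool, ∏ e, bern (p * (1 + ε * χ e s)) (x e) = 1 := fun s ↦ by
    rw [sum_prod_apply (fun e ↦ bern (p * (1 + ε * χ e s)))]
    simp [bern]
  simp [this, sum_uniformWeight]

/-- The second moment of the likelihood ratio. -/
lemma sum_mixtureMass_sq_div_le [Nonempty S] (hε0 : 0 ≤ ε) (hε1 : ε < 1)
    (hχ : ∀ e s, |χ e s| ≤ 1) (hp0 : 0 < p) (hp1 : p ≤ 1 / 4) :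
    ∑ x, mixtureMass χ ε p x ^ 2 / ∏ e, bern p (x e)
      ≤ ∑ z, coupledWeight χ (p * ε ^ 2 / (1 - p)) z := by
  have h1 : ∀ x : E → Bool, mixtureMass χ ε p x ^ 2 / ∏ e, bern p (x e)
      = ∑ z : S × S, uniformWeight S z.1 * uniformWeight S z.2 *
        ∏ e, bern (p * (1 + ε * χ e z.1)) (x e) * bern (p * (1 + ε * χ e z.2)) (x e)
          / bern p (x e) := by
    intro x
    rw [sq, mixtureMass, Finset.sum_mul_sum, Fintype.sum_prod_type, Finset.sum_div]
    refine Finset.sum_congr rfl fun s _ ↦ ?_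
    rw [Finset.sum_div]
    refine Finset.sum_congr rfl fun t _ ↦ ?_
    rw [Finset.prod_div_distrib, Finset.prod_mul_distrib]
    ring
  rw [Finset.sum_congr rfl fun x _ ↦ h1 x, Finset.sum_comm]
  refine Finset.sum_le_sum fun z _ ↦ ?_
  rw [← Finset.mul_sum, sum_prod_apply (fun e c ↦ bern (p * (1 + ε * χ e z.1)) c *
    bern (p * (1 + ε * χ e z.2)) c / bern p c)]
  unfold coupledWeight
  have hU := (mul_pos (uniformWeight_pos z.1) (uniformWeight_pos z.2)).le
  refine mul_le_mul_of_nonneg_left ?_ hU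
  rw [overlap, Finset.mul_sum, Real.exp_sum]
  refine Finset.prod_le_prod (fun e _ ↦ ?_) (fun e _ ↦ ?_)
  · have hb : ∀ s c, 0 < bern (p * (1 + ε * χ e s)) c := fun s c ↦ by
      have h := abs_le.1 (abs_mul_le_of_abs_le_one hε0 hχ e s)
      exact bern_pos (mul_pos hp0 (by linarith)) (by nlinarith) _
    have hb' : ∀ c, 0 < bern p c := bern_pos hp0 (by linarith)
    exact (add_pos (div_pos (mul_pos (hb _ _) (hb _ _)) (hb' _))
      (div_pos (mul_pos (hb _ _) (hb _ _)) (hb' _))).le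
  · rw [sum_bern_mul_div hp0 hp1]
    linarith [Real.add_one_le_exp (p * ε ^ 2 / (1 - p) * (χ e z.1 * χ e z.2))]

/-- Cauchy–Schwarz for the likelihood ratio and the indicator of `B`. -/
lemma sq_sum_mixtureMass_le [Nonempty S] (hε0 : 0 ≤ ε) (hε1 : ε < 1)
    (hχ : ∀ e s, |χ e s| ≤ 1) (hp0 : 0 < p) (hp1 : p ≤ 1 / 4) (B : Finset (E → Bool)) :
    (∑ x ∈ B, mixtureMass χ ε p x) ^ 2
      ≤ (∑ z, coupledWeight χ (p * ε ^ 2 / (1 - p)) z) * ∑ x ∈ B, ∏ e, bern p (x e) := by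
  have hf : ∀ x : E → Bool, 0 < ∏ e, bern p (x e) := fun x ↦
    Finset.prod_pos fun e _ ↦ bern_pos hp0 (by linarith) _
  have h1 := Finset.sum_sq_le_sum_mul_sum_of_sq_le_mul B
    (r := fun x ↦ mixtureMass χ ε p x) (f := fun x ↦ mixtureMass χ ε p x ^ 2 / ∏ e, bern p (x e))
    (g := fun x ↦ ∏ e, bern p (x e))
    (fun x _ ↦ div_nonneg (sq_nonneg _) (hf x).le) (fun x _ ↦ (hf x).le)
    (fun x _ ↦ (div_mul_cancel₀ _ (hf x).ne').ge)
  refine h1.trans (mul_le_mul_of_nonneg_right ?_ (Finset.sum_nonneg fun x _ ↦ (hf x).le))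
  exact (Finset.sum_le_univ_sum_of_nonneg fun x ↦ div_nonneg (sq_nonneg _) (hf x).le).trans
    (sum_mixtureMass_sq_div_le hε0 hε1 hχ hp0 hp1)

omit [Fintype E] [Fintype S] [DecidableEq E] in
-- For an absent edge, the log-ratio is `-p * v` up to an error below `6 * p ^ 2`. For a present
-- edge the extra `exp (-p)` outweighs `exp (-p * v)`, as `v > -1`.
lemma le_bern_div (hp0 : 0 < p) (hp1 : p ≤ 1 / 4) {v : ℝ} (hv : |v| < 1) (c : Bool) :
    (if c then 1 + v else 1) * Real.exp (-p * v) *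
        Real.exp (-p * (if c then 1 else 0) - 6 * p ^ 2) * bern p c ≤ bern (p * (1 + v)) c := by
  obtain ⟨h1, h2⟩ := abs_lt.1 hv
  cases c
  · simp only [bern, Bool.false_eq_true, if_false]
    have hden : 1 / 2 ≤ 1 - p * (1 + v) := by nlinarith
    have hp' : 0 < 1 - p := by linarith
    have hy : 0 < (1 - p * (1 + v)) / (1 - p) := by apply div_pos <;> linarith
    have hlog := Real.one_sub_inv_le_log_of_pos hy
    rw [← le_div_iff₀ hp', one_mul, ← Real.exp_add, ← Real.le_log_iff_exp_le hy]
    refine le_trans ?_ hlog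
    rw [inv_div, ← sub_nonneg]
    have : 1 - (1 - p) / (1 - p * (1 + v)) - (-p * v + (-p * 0 - 6 * p ^ 2))
        = p ^ 2 * (6 - 6 * (p * (1 + v)) - v * (1 + v)) / (1 - p * (1 + v)) := by
      field_simp
      ring
    rw [this]
    refine div_nonneg (mul_nonneg (sq_nonneg _) ?_) (by linarith)
    nlinarith
  · simp only [bern, if_true]
    have : Real.exp (-p * v) * Real.exp (-p * 1 - 6 * p ^ 2) ≤ 1 := by
      rw [← Real.exp_add, Real.exp_le_one_iff]
      nlinarith
    have h3 : 0 ≤ p * (1 + v) := mul_nonneg hp0.le (by linarith)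
    nlinarith [mul_le_mul_of_nonneg_left this h3]

omit [DecidableEq E] in
/-- The likelihood ratio is bounded below by the compensated partition function. -/
lemma le_mixtureMass [Nonempty S] (hε0 : 0 ≤ ε) (hε1 : ε < 1)
    (hχ : ∀ e s, |χ e s| ≤ 1) (hp0 : 0 < p) (hp1 : p ≤ 1 / 4) (x : E → Bool) :
    Real.exp (-p * (∑ e, if x e then 1 else 0) - 6 * p ^ 2 * Fintype.card E)
      * partitionFn (uniformWeight S) (fun e s ↦ ε * χ e s) p x * ∏ e, bern p (x e)
      ≤ mixtureMass χ ε p x := by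
  rw [mixtureMass, partitionFn, Finset.mul_sum, Finset.sum_mul]
  refine Finset.sum_le_sum fun s _ ↦ ?_
  have hv : ∀ e, |ε * χ e s| < 1 := fun e ↦
    (abs_mul_le_of_abs_le_one hε0 hχ e s).trans_lt hε1
  have h1 := Finset.prod_le_prod (s := Finset.univ)
    (f := fun e ↦ (if x e then 1 + ε * χ e s else 1) * Real.exp (-p * (ε * χ e s)) *
        Real.exp (-p * (if x e then 1 else 0) - 6 * p ^ 2) * bern p (x e))
    (g := fun e ↦ bern (p * (1 + ε * χ e s)) (x e))
    (fun e _ ↦ by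
      have h2 := (abs_lt.1 (hv e)).1
      have h3 := bern_pos (q := p) hp0 (by linarith) (x e)
      have h4 : 0 ≤ if x e then 1 + ε * χ e s else 1 := by split_ifs <;> linarith
      positivity)
    (fun e _ ↦ le_bern_div hp0 hp1 (hv e) (x e))
  refine le_trans (le_of_eq ?_) (mul_le_mul_of_nonneg_left h1 (uniformWeight_pos s).le)
  have h5 : ∏ e, Real.exp (-p * (ε * χ e s)) = Real.exp (-p * ∑ e, ε * χ e s) := by
    rw [← Real.exp_sum, Finset.mul_sum]
  have h6 : ∏ e, Real.exp (-p * (if x e then 1 else 0) - 6 * p ^ 2)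
      = Real.exp (-p * (∑ e, if x e then 1 else 0) - 6 * p ^ 2 * Fintype.card E) := by
    rw [← Real.exp_sum, Finset.sum_sub_distrib, ← Finset.mul_sum, Finset.sum_const,
      Finset.card_univ, nsmul_eq_mul, mul_comm (Fintype.card E : ℝ)]
  rw [Finset.prod_mul_distrib, Finset.prod_mul_distrib, Finset.prod_mul_distrib, h5, h6,
    gibbsWeight]
  ring

/-- The constant 7 is 6 from the quadratic errors plus 1 from the mean number of present edges, each
costing `p`. -/
lemma le_bernMean_log_mixtureMass [Nonempty S] (hε0 : 0 ≤ ε) (hε1 : ε < 1)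
    (hχ : ∀ e s, |χ e s| ≤ 1) (hp0 : 0 < p) (hp1 : p ≤ 1 / 4) :
    freeEnergy (uniformWeight S) (fun e s ↦ ε * χ e s) p - 7 * (Fintype.card E * p ^ 2)
      ≤ bernMean p fun x ↦ Real.log (mixtureMass χ ε p x / ∏ e, bern p (x e)) := by
  have h := bernMean_mono (q := p) hp0.le (by linarith)
    (F := fun x : E → Bool ↦ Real.log (partitionFn (uniformWeight S) (fun e s ↦ ε * χ e s) p x)
      + (-p * (∑ e, if x e then 1 else 0) + (-(6 * p ^ 2 * Fintype.card E))))
    (G := fun x ↦ Real.log (mixtureMass χ ε p x / ∏ e, bern p (x e))) fun x ↦ by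
      have hf : 0 < ∏ e, bern p (x e) :=
        Finset.prod_pos fun e _ ↦ bern_pos hp0 (by linarith) _
      have hZ : 0 < partitionFn (uniformWeight S) (fun e s ↦ ε * χ e s) p x :=
        partitionFn_pos uniformWeight_pos fun e s ↦ by
          linarith [(abs_le.1 (abs_mul_le_of_abs_le_one hε0 hχ e s)).1]
      have h1 := le_mixtureMass hε0 hε1 hχ hp0 hp1 x
      rw [← le_div_iff₀ hf] at h1
      have h2 := Real.log_le_log (by positivity) h1
      rw [Real.log_mul (Real.exp_pos _).ne' hZ.ne', Real.log_exp] at h2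
      linarith
  rw [bernMean_add, bernMean_add, bernMean_const_mul, bernMean_card, bernMean_const] at h
  unfold freeEnergy
  linarith

omit [Fintype E] [Fintype S] [DecidableEq E] in
/-- A bound on the Kullback–Leibler divergence controls the mass of events of small mass. -/
lemma sum_mul_log_inv_le {X : Type*} [Fintype X] [DecidableEq X] {f g : X → ℝ} {C κ : ℝ}
    (hf : ∀ x, 0 < f x) (hg : ∀ x, 0 < g x) (hg1 : ∑ x, g x = 1)
    (hC : -C ≤ ∑ x, f x * Real.log (g x / f x)) (hκ : 0 < κ) (B : Finset X) :
    (∑ x ∈ B, f x) * Real.log κ⁻¹ ≤ C + 1 + (∑ x ∈ B, g x) / κ := by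
  rw [← Finset.sum_add_sum_compl B] at hC hg1
  have h1 : ∑ x ∈ B, f x * Real.log (g x / f x)
      ≤ ∑ x ∈ B, (g x / κ - f x * Real.log κ⁻¹) := by
    refine Finset.sum_le_sum fun x _ ↦ ?_
    -- log t ≤ t - 1 is used at `t = g / (f * κ)` on `B`, and at `t = g / f` off `B`.
    have h2 := Real.log_le_sub_one_of_pos (div_pos (div_pos (hg x) (hf x)) hκ)
    rw [Real.log_div (div_pos (hg x) (hf x)).ne' hκ.ne'] at h2
    have h3 := mul_le_mul_of_nonneg_left h2 (hf x).le
    have h4 : f x * (g x / f x / κ - 1) = g x / κ - f x := by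
      have := (hf x).ne'
      field_simp
    rw [Real.log_inv]
    nlinarith [hf x]
  have h2 : ∑ x ∈ Bᶜ, f x * Real.log (g x / f x) ≤ ∑ x ∈ Bᶜ, g x := by
    refine Finset.sum_le_sum fun x _ ↦ ?_
    have h2 := Real.log_le_sub_one_of_pos (div_pos (hg x) (hf x))
    have h3 := mul_le_mul_of_nonneg_left h2 (hf x).le
    have h4 : f x * (g x / f x - 1) = g x - f x := by
      have := (hf x).ne'
      field_simp
    linarith [hf x]
  rw [Finset.sum_sub_distrib, ← Finset.sum_div, ← Finset.sum_mul] at h1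
  have h3 : 0 ≤ ∑ x ∈ B, g x := Finset.sum_nonneg fun x _ ↦ (hg x).le
  linarith

end Likelihood

/-! ### Exponential moment of the overlap -/

section Overlap

/-- The sign attached to a label. -/
def labelSign (c : Bool) : ℝ := if c then 1 else -1

/-- The sign of an edge: `1` if the labels of its endpoints agree and `-1` if they differ. -/
def edgeSign {V : Type*} (e : Sym2 V) (s : V → Bool) : ℝ :=
  Sym2.lift ⟨fun u v ↦ labelSign (s u) * labelSign (s v), fun _ _ ↦ mul_comm _ _⟩ e

lemma edgeSign_mk {V : Type*} (u v : V) (s : V → Bool) :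
    edgeSign s(u, v) s = labelSign (s u) * labelSign (s v) := rfl

lemma labelSign_sq (c : Bool) : labelSign c ^ 2 = 1 := by cases c <;> simp [labelSign]

lemma abs_labelSign (c : Bool) : |labelSign c| = 1 := by cases c <;> simp [labelSign]

lemma abs_edgeSign_le {V : Type*} (e : Sym2 V) (s : V → Bool) : |edgeSign e s| ≤ 1 := by
  induction e using Sym2.ind with
  | _ u v => rw [edgeSign_mk, abs_mul, abs_labelSign, abs_labelSign, mul_one]

/-- Ordered pairs hit each off-diagonal element twice and each diagonal one once; the sum of squares
supplies the missing diagonal copy. -/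
lemma sum_sym2_mul_add_sum_sq {V : Type*} [Fintype V] [DecidableEq V] (f : V → ℝ)
    (F : Sym2 V → ℝ) (hF : ∀ u v, F s(u, v) = f u * f v) :
    2 * ∑ e, F e = (∑ v, f v) ^ 2 + ∑ v, f v ^ 2 := by
  have h1 : ∑ z : V × V, F s(z.1, z.2) = (∑ v, f v) ^ 2 := by
    simp only [hF, Fintype.sum_prod_type, sq, Finset.sum_mul_sum]
  have h2 : ∀ e : Sym2 V, ∑ z : V × V with s(z.1, z.2) = e, F s(z.1, z.2)
      + ∑ v : V with s(v, v) = e, F s(v, v) = 2 * F e := by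
    intro e
    induction e using Sym2.ind with
    | _ a b =>
      by_cases hab : a = b
      · subst hab
        have e1 : (Finset.univ.filter fun z : V × V ↦ s(z.1, z.2) = s(a, a)) = {(a, a)} := by
          ext ⟨u, v⟩; simp
        have e2 : (Finset.univ.filter fun v : V ↦ s(v, v) = s(a, a)) = {a} := by
          ext v; simp
        rw [e1, e2]; simp; ring
      · have e1 : (Finset.univ.filter fun z : V × V ↦ s(z.1, z.2) = s(a, b))
            = {(a, b), (b, a)} := by
          ext ⟨u, v⟩; simp
        have e2 : (Finset.univ.filter fun v : V ↦ s(v, v) = s(a, b)) = ∅ := by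
          ext v
          simp only [Finset.mem_filter, Finset.mem_univ, true_and, Sym2.eq_iff]
          simp only [Finset.notMem_empty, iff_false]
          rintro (⟨rfl, rfl⟩ | ⟨rfl, rfl⟩) <;> exact hab rfl
        rw [e1, e2, Finset.sum_pair (by simp [hab]), Finset.sum_empty, Sym2.eq_swap (a := b)]
        ring
  have h3 := Finset.sum_congr rfl fun e (_ : e ∈ (Finset.univ : Finset (Sym2 V))) ↦ h2 e
  rw [Finset.sum_add_distrib, Finset.sum_fiberwise, Finset.sum_fiberwise, h1,
    ← Finset.mul_sum] at h3
  rw [← h3]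
  simp [hF, sq]

lemma overlap_edgeSign {V : Type*} [Fintype V] [DecidableEq V] (z : (V → Bool) × (V → Bool)) :
    overlap edgeSign z
      = ((∑ v, labelSign (z.1 v) * labelSign (z.2 v)) ^ 2 + Fintype.card V) / 2 := by
  have h := sum_sym2_mul_add_sum_sq (fun v ↦ labelSign (z.1 v) * labelSign (z.2 v))
    (fun e ↦ edgeSign e z.1 * edgeSign e z.2) fun u v ↦ by rw [edgeSign_mk, edgeSign_mk]; ring
  have h2 : ∑ v : V, (labelSign (z.1 v) * labelSign (z.2 v)) ^ 2 = Fintype.card V := by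
    simp [mul_pow, labelSign_sq]
  rw [overlap]
  linarith

/-- Averaging out one sign gives a cosh, and cosh t ≤ exp(t² / 2) is paid for by lowering `D` to `D
- 2`. -/
lemma exp_add_sq_add_exp_sub_sq_le {D : ℝ} (hD : 2 < D) (k y : ℝ) :
    Real.exp ((k + (y + 1) ^ 2) / D) + Real.exp ((k + (y - 1) ^ 2) / D)
      ≤ 2 * Real.exp ((k + 1 + y ^ 2) / (D - 2)) * Real.exp (-k * (1 / (D - 2) - 1 / D)) := by
  have h1 : Real.exp ((k + (y + 1) ^ 2) / D) + Real.exp ((k + (y - 1) ^ 2) / D)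
      = 2 * Real.exp ((k + 1 + y ^ 2) / D) * Real.cosh (2 * y / D) := by
    rw [Real.cosh_eq, show (k + (y + 1) ^ 2) / D = (k + 1 + y ^ 2) / D + 2 * y / D by ring,
      show (k + (y - 1) ^ 2) / D = (k + 1 + y ^ 2) / D + -(2 * y / D) by ring, Real.exp_add,
      Real.exp_add]
    ring
  rw [h1, mul_assoc, mul_assoc]
  refine mul_le_mul_of_nonneg_left ?_ two_pos.le
  refine (mul_le_mul_of_nonneg_left (Real.cosh_le_exp_half_sq _) (Real.exp_pos _).le).trans ?_
  rw [← Real.exp_add, ← Real.exp_add, Real.exp_le_exp]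
  have hD2 : 0 < D - 2 := by linarith
  have hD0 : 0 < D := by linarith
  rw [← sub_nonneg]
  have : (k + 1 + y ^ 2) / (D - 2) + -k * (1 / (D - 2) - 1 / D)
      - ((k + 1 + y ^ 2) / D + (2 * y / D) ^ 2 / 2)
      = (2 * D + 4 * y ^ 2) / (D ^ 2 * (D - 2)) := by
    field_simp
    ring
  rw [this]
  positivity

/-- The exponential moment of the square of a signed sum of independent uniform signs. -/
lemma sum_exp_sq_signed_sum_le (k : ℕ) : ∀ (D : ℝ), 2 * k < D → ∀ (c : Fin k → ℝ),
    (∀ i, |c i| = 1) → ∀ y : ℝ,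
    ∑ t : Fin k → Bool, Real.exp ((y + ∑ i, c i * labelSign (t i)) ^ 2 / D)
      ≤ 2 ^ k * Real.exp ((k + y ^ 2) / (D - 2 * k)) := by
  induction k with
  | zero => intro D _ c _ y; simp
  | succ k ih =>
    intro D hD c hc y
    push_cast at hD
    -- Fixing the first sign shifts `y`, which is why `y` is arbitrary in the induction.
    rw [← Equiv.sum_comp (Fin.consEquiv fun _ ↦ Bool), Fintype.sum_prod_type, Fintype.sum_bool]
    have h1 : ∀ b : Bool, ∑ t : Fin k → Bool, Real.exp ((y + ∑ i, c i *
        labelSign ((Fin.consEquiv fun _ ↦ Bool) (b, t) i)) ^ 2 / D)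
        ≤ 2 ^ k * Real.exp ((k + (y + c 0 * labelSign b) ^ 2) / (D - 2 * k)) := by
      intro b
      refine le_trans (le_of_eq ?_) (ih D (by linarith) (fun i ↦ c i.succ) (fun i ↦ hc _)
        (y + c 0 * labelSign b))
      refine Finset.sum_congr rfl fun t _ ↦ ?_
      rw [Fin.sum_univ_succ, ← add_assoc]
      simp [Fin.consEquiv]
    have h2 : Real.exp ((k + (y + c 0 * labelSign true) ^ 2) / (D - 2 * k))
        + Real.exp ((k + (y + c 0 * labelSign false) ^ 2) / (D - 2 * k))
        = Real.exp ((k + (y + 1) ^ 2) / (D - 2 * k))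
          + Real.exp ((k + (y - 1) ^ 2) / (D - 2 * k)) := by
      rcases eq_or_eq_neg_of_abs_eq (hc 0) with h | h
      · simp [h, labelSign, sub_eq_add_neg]
      · simp [h, labelSign, sub_eq_add_neg, add_comm]
    have h3 := exp_add_sq_add_exp_sub_sq_le (D := D - 2 * k) (by linarith) k y
    have h4 : Real.exp (-k * (1 / (D - 2 * k - 2) - 1 / (D - 2 * k))) ≤ 1 := by
      rw [Real.exp_le_one_iff, neg_mul, neg_nonpos]
      refine mul_nonneg (Nat.cast_nonneg k) (sub_nonneg.2 ?_)
      exact one_div_le_one_div_of_le (by linarith) (by linarith)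
    have h5 : D - 2 * k - 2 = D - 2 * (k + 1 : ℕ) := by push_cast; ring
    have h6 := mul_le_of_le_one_right (a := 2 * Real.exp ((k + 1 + y ^ 2) / (D - 2 * k - 2)))
      (by positivity) h4
    rw [h5] at h6 h3
    calc _ ≤ _ := add_le_add (h1 true) (h1 false)
      _ = 2 ^ k * (Real.exp ((k + (y + 1) ^ 2) / (D - 2 * k))
          + Real.exp ((k + (y - 1) ^ 2) / (D - 2 * k))) := by rw [← h2]; ring
      _ ≤ 2 ^ k * (2 * Real.exp ((k + 1 + y ^ 2) / (D - 2 * (k + 1 : ℕ)))) := by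
          gcongr
          exact h3.trans h6
      _ = _ := by push_cast; ring

/-- The exponential moment of the overlap stays bounded below the critical point. -/
lemma sum_coupledWeight_edgeSign_le {n : ℕ} (hn : 0 < n) {l : ℝ} (hl0 : 0 < l) (hl1 : l < 1) :
    ∑ z, coupledWeight (edgeSign (V := Fin n)) (l / n) z
      ≤ Real.exp (l / 2 + l / (2 * (1 - l))) := by
  have hn' : (0 : ℝ) < n := by exact_mod_cast hn
  have hl : 0 < 1 - l := by linarith
  have h1 : ∀ s : Fin n → Bool, ∑ t, coupledWeight (edgeSign (V := Fin n)) (l / n) (s, t)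
      ≤ uniformWeight (Fin n → Bool) s * Real.exp (l / 2 + l / (2 * (1 - l))) := by
    intro s
    -- With `D = 2 * n / l`, the condition `2 * n < D` is exactly `l < 1`.
    have h2 := sum_exp_sq_signed_sum_le n (2 * n / l) (by
      rw [lt_div_iff₀ hl0]; nlinarith) (fun i ↦ labelSign (s i)) (fun i ↦ abs_labelSign _) 0
    have h3 : ∀ t, coupledWeight (edgeSign (V := Fin n)) (l / n) (s, t)
        = uniformWeight (Fin n → Bool) s * (2 ^ n)⁻¹ * Real.exp (l / 2) *
          Real.exp ((0 + ∑ i, labelSign (s i) * labelSign (t i)) ^ 2 / (2 * n / l)) := by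
      intro t
      have h4 : uniformWeight (Fin n → Bool) t = (2 ^ n)⁻¹ := by simp [uniformWeight]
      rw [coupledWeight, overlap_edgeSign, h4, mul_assoc _ (Real.exp _), ← Real.exp_add]
      congr 2
      rw [Fintype.card_fin, zero_add]
      field_simp
      ring
    have h5 : ((n : ℝ) + 0 ^ 2) / (2 * n / l - 2 * n) = l / (2 * (1 - l)) := by
      have : 2 * (n : ℝ) / l - 2 * n = 2 * n * (1 - l) / l := by field_simp
      rw [this]
      field_simp
      ring
    rw [h5] at h2
    rw [Finset.sum_congr rfl fun t _ ↦ h3 t, ← Finset.mul_sum, Real.exp_add]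
    have hU := uniformWeight_pos s
    calc _ ≤ uniformWeight (Fin n → Bool) s * (2 ^ n)⁻¹ * Real.exp (l / 2) *
          (2 ^ n * Real.exp (l / (2 * (1 - l)))) := by gcongr
      _ = _ := by field_simp
  rw [Fintype.sum_prod_type]
  refine (Finset.sum_le_sum fun s _ ↦ h1 s).trans ?_
  rw [← Finset.sum_mul, sum_uniformWeight, one_mul]

end Overlap

/-! ### The random graph laws as sums over edge configurations -/

section Law

/-- The graph whose edges are the non-diagonal elements marked by `x`. -/
def graphOf {V : Type*} (x : Sym2 V → Bool) : SimpleGraph V :=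
  SimpleGraph.fromEdgeSet {e | x e = true}

variable {V : Type} [Fintype V] [DecidableEq V]

instance : DiscreteMeasurableSpace (SimpleGraph V) where
  forall_measurableSet A := by
    rw [← SimpleGraph.edgeSet_injective.preimage_image A]
    exact SimpleGraph.measurable_edgeSet .of_discrete

/-- A Bernoulli law on `Prop`. -/
def bernoulliProp (r : I) : Measure Prop :=
  toNNReal r • Measure.dirac True + toNNReal (unitInterval.symm r) • Measure.dirac False

instance (r : I) : IsProbabilityMeasure (bernoulliProp r) := by
  unfold bernoulliProp; infer_instance

lemma bernoulliProp_real_singleton (r : I) (c : Bool) :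
    (bernoulliProp r).real {(c = true)} = bern r c := by
  cases c <;> simp [bernoulliProp, bern, measureReal_def]

lemma independentEdges_eq_map (r : Sym2 V → I) :
    independentEdges r = (Measure.pi fun e ↦ bernoulliProp (r e)).map
      fun ω : Sym2 V → Prop ↦ SimpleGraph.fromEdgeSet {e | ω e} := rfl

instance (r : Sym2 V → I) : IsProbabilityMeasure (independentEdges r) := by
  rw [independentEdges_eq_map]
  exact Measure.isProbabilityMeasure_map (measurable_of_countable _).aemeasurable

open Classical in
lemma independentEdges_real_apply (r : Sym2 V → I) (A : Set (SimpleGraph V)) :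
    (independentEdges r).real A
      = ∑ x : Sym2 V → Bool with graphOf x ∈ A, ∏ e, bern (r e) (x e) := by
  rw [independentEdges_eq_map, map_measureReal_apply (measurable_of_countable _) .of_discrete]
  set T := (fun ω : Sym2 V → Prop ↦ SimpleGraph.fromEdgeSet {e | ω e}) ⁻¹' A
  have h1 : T = ((Finset.univ.filter fun ω ↦ ω ∈ T : Finset (Sym2 V → Prop)) : Set _) := by
    ext; simp
  rw [h1, ← sum_measureReal_singleton]
  refine (Finset.sum_equiv (Equiv.piCongrRight fun _ : Sym2 V ↦ Equiv.propEquivBool.symm)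
    (fun x ↦ ?_) (fun x _ ↦ ?_)).symm
  · rw [Finset.mem_filter, Finset.mem_filter]
    simp [T, graphOf, Equiv.propEquivBool]
  · rw [measureReal_def, Measure.pi_singleton, ENNReal.toReal_prod]
    exact Finset.prod_congr rfl fun e _ ↦ (bernoulliProp_real_singleton (r e) (x e)).symm

/-- One law forces the diagonal coordinates to be false, the other draws them and discards them;
masking the diagonal carries one to the other. -/
lemma binomialRandom_eq_independentEdges (p : I) :
    SimpleGraph.binomialRandom V p = independentEdges fun _ ↦ p := by
  rw [SimpleGraph.binomialRandom_eq_map, setBernoulli_eq_map, independentEdges_eq_map,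
    Measure.infinitePi_eq_pi, Measure.map_map (measurable_of_countable _) (by fun_prop)]
  have h1 : ∀ e : Sym2 V, toNNReal p • Measure.dirac (e ∈ Sym2.diagSetᶜ)
      + toNNReal (unitInterval.symm p) • Measure.dirac False
      = (bernoulliProp p).map fun c ↦ c ∧ e ∈ Sym2.diagSetᶜ := fun e ↦ by
    rw [bernoulliProp, Measure.map_add _ _ (measurable_of_countable _), Measure.map_smul,
      Measure.map_smul, Measure.map_dirac, Measure.map_dirac]
    simp
  have h2 : ∀ e : Sym2 V, IsProbabilityMeasure
      ((bernoulliProp p).map fun c ↦ c ∧ e ∈ Sym2.diagSetᶜ) := fun e ↦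
    Measure.isProbabilityMeasure_map (measurable_of_countable _).aemeasurable
  simp only [h1]
  rw [← Measure.pi_map_pi (f := fun e c ↦ c ∧ e ∈ Sym2.diagSetᶜ)
      fun _ ↦ (measurable_of_countable _).aemeasurable,
    Measure.map_map (measurable_of_countable _) (measurable_of_countable _)]
  congr 1
  ext ω u v
  simp +contextual

lemma sparsePlanted_real_apply (a b : ℝ) (n : ℕ) (A : Set (SimpleGraph (Fin n))) :
    (sparsePlanted a b n).real A = ∑ s, uniformWeight (Fin n → Bool) s *
      (independentEdges (edgeProb (sparseProb a n) (sparseProb b n) s)).real A := by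
  have hk : IsMarkovKernel (Kernel.ofFunOfCountable fun s : Fin n → Bool ↦
      independentEdges (edgeProb (sparseProb a n) (sparseProb b n) s)) :=
    ⟨fun s ↦ inferInstanceAs (IsProbabilityMeasure (independentEdges _))⟩
  rw [sparsePlanted, plantedBisection, measureReal_def, Measure.snd_apply .of_discrete,
    Measure.compProd_apply .of_discrete, lintegral_fintype, ENNReal.toReal_sum]
  · refine Finset.sum_congr rfl fun s _ ↦ ?_
    rw [ENNReal.toReal_mul, mul_comm]
    congr 1
    rw [Measure.pi_singleton]
    simp [uniformWeight]
  · intro s _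
    exact ENNReal.mul_ne_top (measure_ne_top _ _) (measure_ne_top _ _)

instance (a b : ℝ) (n : ℕ) : IsProbabilityMeasure (sparsePlanted a b n) := by
  have hk : IsMarkovKernel (Kernel.ofFunOfCountable fun s : Fin n → Bool ↦
      independentEdges (edgeProb (sparseProb a n) (sparseProb b n) s)) :=
    ⟨fun s ↦ inferInstanceAs (IsProbabilityMeasure (independentEdges _))⟩
  unfold sparsePlanted plantedBisection
  infer_instance

instance (c : ℝ) (n : ℕ) : IsProbabilityMeasure (sparseErdosRenyi c n) := by
  unfold sparseErdosRenyi; infer_instance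

lemma coe_sparseProb {c : ℝ} {n : ℕ} (h0 : 0 ≤ c) (hn : 0 < n) (h : c ≤ n) :
    (sparseProb c n : ℝ) = c / n := by
  have hn' : (0 : ℝ) < n := by exact_mod_cast hn
  rw [sparseProb, Set.projIcc_of_mem zero_le_one
    ⟨by positivity, by rwa [div_le_one hn']⟩]

open Classical in
lemma sparseErdosRenyi_real_apply {c : ℝ} {n : ℕ} (h0 : 0 ≤ c) (hn : 0 < n) (h : c ≤ n)
    (A : Set (SimpleGraph (Fin n))) :
    (sparseErdosRenyi c n).real A
      = ∑ x : Sym2 (Fin n) → Bool with graphOf x ∈ A, ∏ e, bern (c / n) (x e) := by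
  rw [sparseErdosRenyi, binomialRandom_eq_independentEdges, independentEdges_real_apply,
    coe_sparseProb h0 hn h]

open Classical in
-- The condition `2 * d ≤ n` keeps both edge probabilities clear of the truncation in `sparseProb`.
lemma sparsePlanted_real_eq_sum_mixtureMass {d ε : ℝ} {n : ℕ} (hd : 0 ≤ d) (h0 : 0 ≤ ε)
    (h1 : ε < 1) (hn : 0 < n) (h : 2 * d ≤ n) (A : Set (SimpleGraph (Fin n))) :
    (sparsePlanted (d * (1 + ε)) (d * (1 - ε)) n).real A
      = ∑ x : Sym2 (Fin n) → Bool with graphOf x ∈ A, mixtureMass edgeSign ε (d / n) x := by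
  have hp : ∀ (s : Fin n → Bool) (e : Sym2 (Fin n)),
      (edgeProb (sparseProb (d * (1 + ε)) n) (sparseProb (d * (1 - ε)) n) s e : ℝ)
        = d / n * (1 + ε * edgeSign e s) := by
    intro s e
    have ha := coe_sparseProb (c := d * (1 + ε)) (by positivity) hn (by nlinarith)
    have hb := coe_sparseProb (c := d * (1 - ε)) (mul_nonneg hd (by linarith)) hn (by nlinarith)
    induction e using Sym2.ind with
    | _ u v =>
      rw [edgeSign_mk]
      simp only [edgeProb, Sym2.lift_mk]
      by_cases huv : s u = s v
      · rw [if_pos huv, ha, huv, ← sq, labelSign_sq]; ring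
      · rw [if_neg huv, hb]
        have : labelSign (s u) * labelSign (s v) = -1 := by
          cases hu : s u <;> cases hv : s v <;> simp_all [labelSign]
        rw [this]; ring
  rw [sparsePlanted_real_apply]
  simp only [independentEdges_real_apply, hp, mixtureMass, Finset.mul_sum]
  rw [Finset.sum_comm]

end Law

/-! ### Contiguity and non-estimability -/

section Contiguity

lemma card_sym2_fin_le {n : ℕ} (hn : 0 < n) :
    (Fintype.card (Sym2 (Fin n)) : ℝ) ≤ (n : ℝ) ^ 2 := by
  rw [Sym2.card, Fintype.card_fin, Nat.cast_choose_two]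
  have : (1 : ℝ) ≤ n := by exact_mod_cast hn
  push_cast
  nlinarith

lemma sum_coupledWeight_mono {n : ℕ} {θ θ' : ℝ} (h : θ ≤ θ') :
    ∑ z, coupledWeight (edgeSign (V := Fin n)) θ z
      ≤ ∑ z, coupledWeight (edgeSign (V := Fin n)) θ' z := by
  refine Finset.sum_le_sum fun z _ ↦ ?_
  have h0 : 0 ≤ overlap edgeSign z := by rw [overlap_edgeSign]; positivity
  have h1 := (mul_pos (uniformWeight_pos z.1) (uniformWeight_pos z.2)).le
  unfold coupledWeight
  gcongr

variable {d ε : ℝ}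

/-- Below the critical point, the second moment of the likelihood ratio is bounded. -/
lemma exists_sq_sparsePlanted_le (hd : 0 < d) (h0 : 0 < ε) (h1 : ε < 1) (hcrit : d * ε ^ 2 < 1) :
    ∃ K : ℝ, ∀ᶠ n : ℕ in atTop, ∀ A : Set (SimpleGraph (Fin n)),
      (sparsePlanted (d * (1 + ε)) (d * (1 - ε)) n).real A ^ 2
        ≤ K * (sparseErdosRenyi d n).real A := by
  classical
  obtain ⟨l, hl, hl1⟩ := exists_between hcrit
  have hl0 : 0 < l := lt_trans (by positivity) hl
  refine ⟨Real.exp (l / 2 + l / (2 * (1 - l))), ?_⟩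
  -- The last threshold is what makes `d / n * ε ^ 2 / (1 - d / n) ≤ l / n`.
  filter_upwards [eventually_gt_atTop 0, tendsto_natCast_atTop_atTop.eventually_ge_atTop (4 * d),
    tendsto_natCast_atTop_atTop.eventually_ge_atTop (d * l / (l - d * ε ^ 2))] with n hn hn4 hnl A
  have hn' : (0 : ℝ) < n := by exact_mod_cast hn
  have hp1 : d / n ≤ 1 / 4 := by rw [div_le_iff₀ hn']; linarith
  rw [sparsePlanted_real_eq_sum_mixtureMass hd.le h0.le h1 hn (by linarith),
    sparseErdosRenyi_real_apply hd.le hn (by linarith)]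
  refine (sq_sum_mixtureMass_le h0.le h1 abs_edgeSign_le (by positivity) hp1 _).trans
    (mul_le_mul_of_nonneg_right ?_ (Finset.sum_nonneg fun x _ ↦
      prod_bern_nonneg (by positivity) (by linarith) x))
  refine le_trans (sum_coupledWeight_mono ?_) (sum_coupledWeight_edgeSign_le hn hl0 hl1)
  have h2 : 0 < 1 - d / n := by linarith
  rw [div_le_iff₀ (by linarith)] at hnl
  rw [div_le_div_iff₀ h2 hn']
  have h3 : d / n * ε ^ 2 * n = d * ε ^ 2 := by field_simp
  have h4 : d / n * (n * (l - d * ε ^ 2)) = d * (l - d * ε ^ 2) := by field_simp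
  have h5 : d / n * (d * l) ≤ d / n * (n * (l - d * ε ^ 2)) := by gcongr
  have h6 : d * (d / n * l) ≤ d * (l - d * ε ^ 2) := by linarith
  have h7 := le_of_mul_le_mul_left h6 hd
  rw [h3]
  linarith

/-- Below the critical point, events of small mass in the planted model have small mass in the
Erdős–Rényi model. -/
lemma exists_sparseErdosRenyi_mul_log_le (hd : 0 < d) (h0 : 0 < ε) (h1 : ε < 1)
    (hcrit : d * ε ^ 2 < 1) :
    ∃ C : ℝ, 0 ≤ C ∧ ∀ᶠ n : ℕ in atTop, ∀ A : Set (SimpleGraph (Fin n)), ∀ κ : ℝ, 0 < κ →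
      (sparseErdosRenyi d n).real A * Real.log κ⁻¹
        ≤ C + (sparsePlanted (d * (1 + ε)) (d * (1 - ε)) n).real A / κ := by
  classical
  obtain ⟨l, hl, hl1⟩ := exists_between hcrit
  have hl0 : 0 < l := lt_trans (by positivity) hl
  have hl1' : 0 < 1 - l := by linarith
  obtain ⟨C, hC⟩ : ∃ C : ℝ, ∀ n : ℕ, 0 < n → d ≤ n →
      -C ≤ freeEnergy (uniformWeight (Fin n → Bool)) (fun e s ↦ ε * edgeSign e s) (d / n) := by
    refine ⟨freeEnergyBound ε d (l - d * ε ^ 2) (l / 2 + l / (2 * (1 - l))), fun n hn hdn ↦ ?_⟩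
    have hn' : (0 : ℝ) < n := by exact_mod_cast hn
    refine le_freeEnergy (χ := edgeSign (V := Fin n)) (l := l) (δ := l - d * ε ^ 2)
      (C := l / 2 + l / (2 * (1 - l))) h0 h1
      abs_edgeSign_le hn' hd.le (by rwa [div_le_one hn']) (card_sym2_fin_le hn) (by linarith)
      le_rfl ?_
    rw [Real.log_le_iff_le_exp (Finset.sum_pos (fun z _ ↦ coupledWeight_pos z)
      Finset.univ_nonempty)]
    exact sum_coupledWeight_edgeSign_le hn hl0 hl1
  refine ⟨max (C + 7 * d ^ 2 + 1) 0, le_max_right _ _, ?_⟩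
  filter_upwards [eventually_gt_atTop 0,
    tendsto_natCast_atTop_atTop.eventually_ge_atTop (4 * d)] with n hn hn4 A κ hκ
  have hn' : (0 : ℝ) < n := by exact_mod_cast hn
  have hp0 : 0 < d / n := by positivity
  have hp1 : d / n ≤ 1 / 4 := by rw [div_le_iff₀ hn']; linarith
  rw [sparsePlanted_real_eq_sum_mixtureMass hd.le h0.le h1 hn (by linarith),
    sparseErdosRenyi_real_apply hd.le hn (by linarith)]
  have h2 := le_bernMean_log_mixtureMass (χ := edgeSign (V := Fin n)) h0.le h1 abs_edgeSign_le
    hp0 hp1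
  have h3 := hC n hn (by linarith)
  have h4 : (Fintype.card (Sym2 (Fin n)) : ℝ) * (d / n) ^ 2 ≤ d ^ 2 := by
    calc (Fintype.card (Sym2 (Fin n)) : ℝ) * (d / n) ^ 2 ≤ (n : ℝ) ^ 2 * (d / n) ^ 2 := by
          gcongr; exact card_sym2_fin_le hn
      _ = d ^ 2 := by field_simp
  refine (sum_mul_log_inv_le (C := C + 7 * d ^ 2) (fun x ↦ Finset.prod_pos fun e _ ↦
    bern_pos hp0 (by linarith) _) (mixtureMass_pos h0.le h1 abs_edgeSign_le hp0 hp1)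
    sum_mixtureMass ?_ hκ _).trans (add_le_add_left (le_max_left _ _) _)
  have h5 : -(C + 7 * d ^ 2) ≤ bernMean (d / n) fun x : Sym2 (Fin n) → Bool ↦
      Real.log (mixtureMass edgeSign ε (d / n) x / ∏ e, bern (d / n) (x e)) := by linarith
  exact h5

lemma tendsto_measure_zero_iff {Ω : ℕ → Type} [∀ n, MeasurableSpace (Ω n)]
    (P : ∀ n, Measure (Ω n)) [∀ n, IsProbabilityMeasure (P n)] (A : ∀ n, Set (Ω n)) :
    Tendsto (fun n ↦ P n (A n)) atTop (𝓝 0) ↔ Tendsto (fun n ↦ (P n).real (A n)) atTop (𝓝 0) := by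
  rw [← ENNReal.toReal_zero]
  exact (ENNReal.tendsto_toReal_iff (fun n ↦ measure_ne_top _ _) ENNReal.zero_ne_top).symm

lemma mutuallyContiguous_of_lt_one (hd : 0 < d) (h0 : 0 < ε) (h1 : ε < 1)
    (hcrit : d * ε ^ 2 < 1) :
    MutuallyContiguous (sparsePlanted (d * (1 + ε)) (d * (1 - ε))) (sparseErdosRenyi d) := by
  intro A _
  rw [tendsto_measure_zero_iff, tendsto_measure_zero_iff]
  constructor
  · intro hP
    obtain ⟨C, hC0, hC⟩ := exists_sparseErdosRenyi_mul_log_le hd h0 h1 hcrit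
    rw [Metric.tendsto_nhds]
    intro η hη
    -- With `κ = exp (-L)`, once P(A) ≤ κ the entropy bound gives Q(A) L ≤ C + 1 < η L.
    set L := (C + 2) / η with hL
    have hL0 : 0 < L := by positivity
    filter_upwards [hC, hP.eventually_le_const (Real.exp_pos (-L))] with n h2 h3
    have h4 := h2 (A n) _ (Real.exp_pos (-L))
    rw [← Real.exp_neg, neg_neg, Real.log_exp] at h4
    have h5 := (div_le_one (Real.exp_pos (-L))).2 h3
    have h6 : (sparseErdosRenyi d n).real (A n) * L < η * L := by
      rw [hL, mul_div_cancel₀ _ hη.ne', ← hL]; linarith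
    rw [Real.dist_eq, sub_zero, abs_of_nonneg measureReal_nonneg]
    exact lt_of_mul_lt_mul_right h6 hL0.le
  · intro hQ
    obtain ⟨K, hK⟩ := exists_sq_sparsePlanted_le hd h0 h1 hcrit
    have h2 : Tendsto (fun n ↦ (sparsePlanted (d * (1 + ε)) (d * (1 - ε)) n).real (A n) ^ 2)
        atTop (𝓝 0) := by
      refine squeeze_zero' (.of_forall fun n ↦ sq_nonneg _) (hK.mono fun n h ↦ h (A n)) ?_
      simpa using hQ.const_mul K
    have h3 := h2.sqrt
    simpa [Real.sqrt_sq measureReal_nonneg] using h3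

lemma mutuallyContiguous_sparse {a b : ℝ} (hb : 0 < b) (hab : b < a)
    (h : (a - b) ^ 2 < 2 * (a + b)) :
    MutuallyContiguous (sparsePlanted a b) (sparseErdosRenyi ((a + b) / 2)) := by
  have hs : 0 < a + b := by linarith
  have h1 := mutuallyContiguous_of_lt_one (d := (a + b) / 2) (ε := (a - b) / (a + b))
    (by positivity) (div_pos (by linarith) hs) (by rw [div_lt_one hs]; linarith) (by
      have : (a + b) / 2 * ((a - b) / (a + b)) ^ 2 = (a - b) ^ 2 / (2 * (a + b)) := by
        field_simp
      rw [this, div_lt_one (by positivity)]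
      exact h)
  have ha : (a + b) / 2 * (1 + (a - b) / (a + b)) = a := by field_simp; ring
  have hb' : (a + b) / 2 * (1 - (a - b) / (a + b)) = b := by field_simp; ring
  rwa [ha, hb'] at h1

/-- A functional that takes different values at two parameters contiguous to the same Erdős–Rényi
model has no consistent estimator. -/
lemma not_isConsistentEstimator {Θ : Set (ℝ × ℝ)} {f : ℝ × ℝ → ℝ} {θ θ' : ℝ × ℝ} {c : ℝ}
    (hθ : θ ∈ Θ) (hθ' : θ' ∈ Θ)
    (h : MutuallyContiguous (sparsePlanted θ.1 θ.2) (sparseErdosRenyi c))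
    (h' : MutuallyContiguous (sparsePlanted θ'.1 θ'.2) (sparseErdosRenyi c)) (hf : f θ ≠ f θ') :
    ¬ ∃ T : ∀ n, SimpleGraph (Fin n) → ℝ, IsConsistentEstimator Θ f T := by
  rintro ⟨T, hT⟩
  set η := |f θ - f θ'| / 3 with hη
  have hpos : 0 < |f θ - f θ'| := abs_pos.2 (sub_ne_zero.2 hf)
  have hη0 : 0 < η := by positivity
  have h1 := (h _ fun _ ↦ .of_discrete).1 (hT θ hθ η hη0)
  have h2 := (h' _ fun _ ↦ .of_discrete).1 (hT θ' hθ' η hη0)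
  have h3 := h1.add h2
  rw [add_zero] at h3
  -- An estimate cannot be within a third of the gap of both values, so the two error events cover
  -- all graphs, yet both have vanishing Erdős–Rényi probability.
  refine absurd (ge_of_tendsto' h3 (b := 1) fun n ↦ ?_) (by simp)
  rw [← measure_univ (μ := sparseErdosRenyi c n)]
  refine le_trans (measure_mono fun G _ ↦ ?_) (measure_union_le _ _)
  by_contra hG
  simp only [Set.mem_union, Set.mem_ofPred_eq, not_or, not_lt] at hG
  have h4 := abs_sub_le (f θ) (T n G) (f θ')
  rw [abs_sub_comm (f θ) (T n G)] at h4
  linarith [hG.1, hG.2]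

end Contiguity

end

end BlockModel

theorem theorem2p4 (a b : ℝ) (hb : 0 < b) (hab : b < a) (h : (a - b) ^ 2 < 2 * (a + b)) :
    BlockModel.MutuallyContiguous (BlockModel.sparsePlanted a b)
        (BlockModel.sparseErdosRenyi ((a + b) / 2)) ∧
      ∀ Θ : Set (ℝ × ℝ), (∀ θ ∈ Θ, 0 < θ.2 ∧ θ.2 < θ.1) → (a, b) ∈ Θ →
        (∃ θ ∈ Θ, θ ∈ BlockModel.subcritical ∧ θ ≠ (a, b) ∧ θ.1 + θ.2 = a + b) →
        (¬ ∃ T : ∀ n, SimpleGraph (Fin n) → ℝ, BlockModel.IsConsistentEstimator Θ Prod.fst T) ∧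
          ¬ ∃ T : ∀ n, SimpleGraph (Fin n) → ℝ, BlockModel.IsConsistentEstimator Θ Prod.snd T := by
  have hcont := BlockModel.mutuallyContiguous_sparse hb hab h
  refine ⟨hcont, fun Θ _ hΘ ⟨θ, hθΘ, hθ, hne, hsum⟩ ↦ ?_⟩
  have hcont' := BlockModel.mutuallyContiguous_sparse hθ.1 hθ.2.1 hθ.2.2
  rw [hsum] at hcont'
  have hfst : (a, b).1 ≠ θ.1 := fun heq ↦ hne (Prod.ext heq.symm (by
    simp only at heq ⊢; linarith))
  have hsnd : (a, b).2 ≠ θ.2 := fun heq ↦ hfst (by simp only at heq ⊢; linarith)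
  exact ⟨BlockModel.not_isConsistentEstimator hΘ hθΘ hcont hcont' hfst,
    BlockModel.not_isConsistentEstimator hΘ hθΘ hcont hcont' hsnd⟩
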